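/- **Theorem 1.1 (existence of minimizers).** Let $\varepsilon>0$, $N\ge 2$, $x_1,\dots,x_N\in\mathbb{R}^2$, $\delta>0$, $s\in(0,1)$ and $1\le p<\infty$. Identify $\mathbb{R}^2$ with $\mathbb{C}$. For a Lipschitz curve $\gamma:\mathbb{R}/\mathbb{Z}\to\mathbb{R}^2$ and $x\notin\gamma(\mathbb{R}/\mathbb{Z})$ let $$\omega(\gamma,x)=\frac1{2\pi i}\int_{\mathbb{R}/\mathbb{Z}}\frac{\dot\gamma(t)}{\gamma(t)-x}\,dt$$ be the winding number. Let $\mathcal{E}$ be the class of all closed Lipschitz curves $\gamma:\mathbb{R}/\mathbb{Z}\to\mathbb{R}^2$ such that 1. $\{x_1,\dots,x_N\}\subset\gamma(\mathbb{R}/\mathbb{Z})$; 2. $\omega(\gamma,x)\in\{0,1\}$ for every $x\notin\gamma(\mathbb{R}/\mathbb{Z})$; 3. the set $\{x\in\mathbb{R}^2\setminus\gamma(\mathbb{R}/\mathbb{Z}):\omega(\gamma,x)=1\}$ has Lebesgue measure $\varepsilon$; 4. $\gamma$ has constant speed, i.e. there is $C>0$ with $|\dot\gamma(t)|=C$ for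 almost every $t$. For $\gamma\in\mathcal{E}$ let $\tau(t)=\dot\gamma(t)/|\dot\gamma(t)|$, let $\ell(\gamma)=\sup\sum_{i=1}^k|\gamma(t_i)-\gamma(t_{i-1})|$, over all partitions $0=t_0<t_1<\dots<t_k=1$, be the length of $\gamma$, and let $$G_\delta(\gamma)=\ell(\gamma)+\delta\int_{\mathbb{R}/\mathbb{Z}}\int_{\mathbb{R}/\mathbb{Z}}\frac{|\tau(t)-\tau(t')|^p}{|\gamma(t)-\gamma(t')|^{1+sp}}\,|\dot\gamma(t)|\,|\dot\gamma(t')|\,dt\,dt'\in[0,\infty].$$ Then $G_\delta$ attains a finite minimum on $\mathcal{E}$: there is $\gamma\in\mathcal{E}$ with $G_\delta(\gamma)<\infty$ and $G_\delta(\gamma)\le G_\delta(\tilde\gamma)$ for all $\tilde\gamma\in\mathcal{E}$. -/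

import Mathlib

open MeasureTheory
open scoped ENNReal NNReal

noncomputable section

namespace ClosedCurve

/-- The `1`-periodic function on `ℝ` given by a closed curve `γ : ℝ/ℤ → ℝ² = ℂ`. -/
def lift (γ : UnitAddCircle → ℂ) : ℝ → ℂ := fun t => γ (t : UnitAddCircle)

/-- The velocity `γ'(t)`; by Rademacher's theorem it exists for almost every `t`
when `γ` is Lipschitz. -/
def velocity (γ : UnitAddCircle → ℂ) (t : ℝ) : ℂ := deriv (lift γ) t

/-- The unit tangent `τ(t) = γ'(t) / |γ'(t)|`. -/
def tangent (γ : UnitAddCircle → ℂ) (t : ℝ) : ℂ := velocity γ t / (‖velocity γ t‖ : ℂ)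

/-- The length of `γ`: the supremum of the lengths of inscribed polygons over all partitions
of `[0, 1]`. -/
def length (γ : UnitAddCircle → ℂ) : ℝ≥0∞ := eVariationOn (lift γ) (Set.Icc 0 1)

/-- The speed `|γ'|` is almost everywhere equal to a positive constant. -/
def HasConstantSpeed (γ : UnitAddCircle → ℂ) : Prop :=
  ∃ C : ℝ, 0 < C ∧ ∀ᵐ t : ℝ, ‖velocity γ t‖ = C

/-- The winding number `(2πi)⁻¹ ∫₀¹ γ'(t) / (γ(t) - x) dt` of `γ` about a point `x` that does not
lie on `γ`. -/
def windingNumber (γ : UnitAddCircle → ℂ) (x : ℂ) : ℂ :=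
  (2 * Real.pi * Complex.I)⁻¹ * ∫ t in (0 : ℝ)..1, velocity γ t / (lift γ t - x)

/-- The interior of `γ`: the points off `γ` about which the winding number is `1`. -/
def interior (γ : UnitAddCircle → ℂ) : Set ℂ :=
  {x | x ∉ Set.range γ ∧ windingNumber γ x = 1}

/-- The nonlocal energy
`∬ |τ(t) - τ(t')|^p / |γ(t) - γ(t')|^(1 + s p) |γ'(t)| |γ'(t')| dt dt'`, with values in `[0, ∞]`. -/
def nonlocalEnergy (s p : ℝ) (γ : UnitAddCircle → ℂ) : ℝ≥0∞ :=
  ∫⁻ t in Set.Ioc (0 : ℝ) 1, ∫⁻ t' in Set.Ioc (0 : ℝ) 1,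
    ‖tangent γ t - tangent γ t'‖ₑ ^ p / ‖lift γ t - lift γ t'‖ₑ ^ (1 + s * p)
      * ‖velocity γ t‖ₑ * ‖velocity γ t'‖ₑ

/-- The functional `G_δ`: length plus `δ` times the nonlocal energy. -/
def totalEnergy (δ s p : ℝ) (γ : UnitAddCircle → ℂ) : ℝ≥0∞ :=
  length γ + ENNReal.ofReal δ * nonlocalEnergy s p γ

/-- The admissible class `𝓔`: closed Lipschitz curves of constant speed that pass through the
points `x i`, have all winding numbers in `{0, 1}`, and enclose area `ε`. -/
def admissible (ε : ℝ) {N : ℕ} (x : Fin N → ℂ) : Set (UnitAddCircle → ℂ) :=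
  {γ | (∃ K : ℝ≥0, LipschitzWith K γ) ∧
    (∀ i, x i ∈ Set.range γ) ∧
    (∀ z, z ∉ Set.range γ → windingNumber γ z = 0 ∨ windingNumber γ z = 1) ∧
    volume (interior γ) = ENNReal.ofReal ε ∧
    HasConstantSpeed γ}

end ClosedCurve

end

open MeasureTheory
open scoped ENNReal NNReal

namespace ClosedCurve

open Set Filter Topology Measure
open scoped ContDiff

noncomputable section

/-! The proof is the direct method. A constant-speed curve has length equal to its speed
(`length_le`, `le_length`), so along a minimizing sequence the speeds are bounded; all curves pass
through a fixed point, and Arzelà-Ascoli gives a uniform limit.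

Uniform convergence alone does not preserve constant speed or control the winding numbers. The
nonlocal energy supplies the missing strong compactness: it bounds the `L¹` distance between the
velocity and the difference quotient of step `h` by `r + const * r ^ (1 - p) * h ^ (s * p) * energy`
for every `r > 0` (`lintegral_velocity_sub_quotient_le`). Difference quotients converge with the
curves, so velocities converge in `L¹`, and almost everywhere along a subsequence. Then speeds and
winding numbers pass to the limit, the winding numbers off the limit curve. The curve is a null set,
so the enclosed areas converge by dominated convergence; the positive area excludes a constant
limit. Length converges, and Fatou's lemma gives lower semicontinuity of the energy.

The infimum must also be finite. Viewed from a centre off every line through two of the points,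
distinct points lie in distinct directions. A smooth positive function of the direction, with
prescribed values in these directions and prescribed integral, is taken as the squared radius of a
star-shaped curve through the points enclosing area `ε`. Parametrised by arc length this curve is
smooth and bi-Lipschitz, so its energy density is at most a constant times `|t - t'| ^ (p - 1 - s *
p)`, which is integrable because `s < 1`. -/

/-- The fundamental theorem of calculus for planar Lipschitz curves. -/
theorem _root_.LipschitzWith.integral_deriv_eq_sub_complex {K : ℝ≥0} {f : ℝ → ℂ}
    (hf : LipschitzWith K f) (a b : ℝ) : ∫ t in a..b, deriv f t = f b - f a := by
  have hbd : ∀ t, ‖deriv f t‖ ≤ K := fun t => norm_deriv_le_of_lipschitz hf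
  have hint : IntervalIntegrable (deriv f) volume a b := by
    refine (intervalIntegrable_const (c := (K : ℝ))).mono_fun
      (measurable_deriv f).aestronglyMeasurable (Eventually.of_forall fun t => ?_)
    simpa using hbd t
  have hre : LipschitzWith K (fun t => (f t).re) := by
    refine LipschitzWith.of_dist_le_mul fun x y => ?_
    refine le_trans ?_ (hf.dist_le_mul x y)
    rw [Real.dist_eq, ← Complex.sub_re, dist_eq_norm]
    exact Complex.abs_re_le_norm _
  have him : LipschitzWith K (fun t => (f t).im) := by
    refine LipschitzWith.of_dist_le_mul fun x y => ?_
    refine le_trans ?_ (hf.dist_le_mul x y)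
    rw [Real.dist_eq, ← Complex.sub_im, dist_eq_norm]
    exact Complex.abs_im_le_norm _
  have hd := hf.ae_differentiableAt_real
  apply Complex.ext
  · rw [Complex.sub_re, ← (hre.lipschitzOnWith.absolutelyContinuousOnInterval).integral_deriv_eq_sub]
    have := Complex.reCLM.intervalIntegral_comp_comm hint
    simp only [Complex.reCLM_apply] at this
    rw [← this]
    refine intervalIntegral.integral_congr_ae ?_
    filter_upwards [hd] with t ht _
    exact ((Complex.reCLM.hasFDerivAt.comp_hasDerivAt t ht.hasDerivAt).deriv).symm
  · rw [Complex.sub_im, ← (him.lipschitzOnWith.absolutelyContinuousOnInterval).integral_deriv_eq_sub]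
    have := Complex.imCLM.intervalIntegral_comp_comm hint
    simp only [Complex.imCLM_apply] at this
    rw [← this]
    refine intervalIntegral.integral_congr_ae ?_
    filter_upwards [hd] with t ht _
    exact ((Complex.imCLM.hasFDerivAt.comp_hasDerivAt t ht.hasDerivAt).deriv).symm

/-! ### Periodic lifts, speed and length. -/

theorem lift_add_one (γ : UnitAddCircle → ℂ) (t : ℝ) : lift γ (t + 1) = lift γ t := by
  simp [lift]

theorem velocity_add_one (γ : UnitAddCircle → ℂ) (t : ℝ) : velocity γ (t + 1) = velocity γ t := by
  have h : (fun t => lift γ (t + 1)) = lift γ := funext (lift_add_one γ)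
  have h2 := deriv_comp_add_const (f := lift γ) 1 t
  rw [h] at h2
  exact h2.symm

theorem tangent_add_one (γ : UnitAddCircle → ℂ) (t : ℝ) : tangent γ (t + 1) = tangent γ t := by
  simp [tangent, velocity_add_one]

theorem range_lift (γ : UnitAddCircle → ℂ) : range (lift γ) = range γ :=
  (QuotientAddGroup.mk_surjective (s := AddSubgroup.zmultiples (1 : ℝ))).range_comp γ

theorem lipschitzWith_coe : LipschitzWith 1 (fun t : ℝ => (t : UnitAddCircle)) := by
  refine LipschitzWith.of_dist_le_mul fun x y => ?_
  rw [dist_eq_norm, ← AddCircle.coe_sub, dist_eq_norm, NNReal.coe_one, one_mul]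
  exact QuotientAddGroup.norm_mk_le_norm

theorem lipschitzWith_lift {K : ℝ≥0} {γ : UnitAddCircle → ℂ} (h : LipschitzWith K γ) :
    LipschitzWith K (lift γ) := by
  have := h.comp lipschitzWith_coe
  rwa [mul_one] at this

theorem measurable_velocity (γ : UnitAddCircle → ℂ) : Measurable (velocity γ) :=
  measurable_deriv _

theorem measurable_tangent (γ : UnitAddCircle → ℂ) : Measurable (tangent γ) := by
  have := measurable_velocity γ
  unfold tangent
  fun_prop

/-- The integral of a `1`-periodic function over any interval of length one. -/
theorem lintegral_Ioc_eq_of_periodic {g : ℝ → ℝ≥0∞} (hg : Function.Periodic g 1) (a b : ℝ) :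
    ∫⁻ t in Ioc a (a + 1), g t = ∫⁻ t in Ioc b (b + 1), g t := by
  have h1 := UnitAddCircle.lintegral_preimage a hg.lift
  have h2 := UnitAddCircle.lintegral_preimage b hg.lift
  simp only [Function.Periodic.lift_coe] at h1 h2
  rw [h1, h2]

/-- A `1`-periodic property that holds almost everywhere on a period holds almost everywhere. -/
theorem ae_of_ae_Ioc {q : ℝ → Prop} (hq : ∀ t, q (t + 1) ↔ q t)
    (h : ∀ᵐ t ∂volume.restrict (Ioc (0 : ℝ) 1), q t) : ∀ᵐ t, q t := by
  have hz : ∀ (n : ℤ) t, q (t + n) ↔ q t := by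
    intro n t
    have hp : Function.Periodic q 1 := fun t => propext (hq t)
    have := (hp.int_mul n) t
    rw [mul_one] at this
    exact Iff.of_eq this
  rw [ae_iff]
  refine (isAddFundamentalDomain_Ioc one_pos 0 volume).measure_zero_of_invariant _ ?_ ?_
  · rintro ⟨g, hg⟩
    obtain ⟨n, rfl⟩ := AddSubgroup.mem_zmultiples_iff.1 hg
    ext t
    rw [Set.mem_vadd_set_iff_neg_vadd_mem]
    simp only [mem_ofPred_eq]
    rw [not_iff_not]
    have := hz (-n) t
    rw [← this]
    simp [AddSubgroup.vadd_def, add_comm]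
  · rw [ae_restrict_iff' measurableSet_Ioc, ae_iff] at h
    refine measure_mono_null ?_ h
    rintro t ⟨h1, h2⟩
    simp only [zero_add] at h2
    exact fun h => h1 (h h2)

/-- Upgrades the arbitrary Lipschitz constant in the admissible class to the speed itself. -/
theorem lipschitzWith_of_ae_norm_deriv_le {K : ℝ≥0} {f : ℝ → ℂ} (hf : LipschitzWith K f) {C : ℝ≥0}
    (hC : ∀ᵐ t, ‖deriv f t‖ ≤ C) : LipschitzWith C f := by
  refine LipschitzWith.of_dist_le_mul fun x y => ?_
  rw [dist_eq_norm, ← hf.integral_deriv_eq_sub_complex y x, Real.dist_eq]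
  exact intervalIntegral.norm_integral_le_of_norm_le_const_ae (hC.mono fun t ht _ => ht)

theorem length_le {C : ℝ≥0} {γ : UnitAddCircle → ℂ} (h : LipschitzWith C (lift γ)) :
    length γ ≤ C := by
  have h1 := (h.lipschitzOnWith (s := univ)).comp_eVariationOn_le (g := id) (s := Icc (0 : ℝ) 1)
    (mapsTo_univ _ _)
  have h2 : eVariationOn (id : ℝ → ℝ) (Icc 0 1) = ENNReal.ofReal (id 1 - id 0) := by
    simp
  calc length γ ≤ C * eVariationOn (id : ℝ → ℝ) (Icc 0 1) := h1
    _ = C * ENNReal.ofReal (id 1 - id 0) := by rw [h2]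
    _ = C := by simp

/-- The variation function `V` is monotone and its increments dominate those of the curve, so `V' ≥
C` almost everywhere; for a monotone function the integral of `V'` is at most the increment of `V`,
which here is the length. -/
theorem le_length {K : ℝ≥0} {γ : UnitAddCircle → ℂ} (h : LipschitzWith K (lift γ)) {C : ℝ≥0}
    (hC : ∀ᵐ t, ‖velocity γ t‖ = C) : (C : ℝ≥0∞) ≤ length γ := by
  have hbv : LocallyBoundedVariationOn (lift γ) univ :=
    h.lipschitzOnWith.locallyBoundedVariationOn
  set V := variationOnFromTo (lift γ) univ 0 with hV
  have hmono : Monotone V := monotoneOn_univ.1 (variationOnFromTo.monotoneOn hbv (mem_univ 0))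
  have hle : ∀ a b, a ≤ b → ‖lift γ b - lift γ a‖ ≤ V b - V a := by
    intro a b hab
    have hadd := variationOnFromTo.add hbv (mem_univ 0) (mem_univ a) (mem_univ b)
    have heq := variationOnFromTo.eq_of_le (lift γ) univ hab
    have hne := hbv a b (mem_univ a) (mem_univ b)
    have hed := eVariationOn.edist_le (lift γ) (s := univ ∩ Icc a b) (x := b) (y := a)
      ⟨mem_univ _, hab, le_rfl⟩ ⟨mem_univ _, le_rfl, hab⟩
    rw [← dist_eq_norm, dist_edist]
    have := ENNReal.toReal_mono hne hed
    simp only [hV]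
    linarith
  have hae : ∀ᵐ t, (C : ℝ) ≤ deriv V t := by
    filter_upwards [hC, h.ae_differentiableAt_real, hmono.ae_differentiableAt] with t ht h1 h2
    rw [← ht]
    have l1 := (h1.hasDerivAt.tendsto_slope_zero_right).norm
    have l2 := h2.hasDerivAt.tendsto_slope_zero_right
    refine le_of_tendsto_of_tendsto l1 l2 ?_
    filter_upwards [self_mem_nhdsWithin] with r hr
    have hr : 0 < r := hr
    rw [norm_smul, norm_inv, Real.norm_of_nonneg hr.le, smul_eq_mul]
    gcongr
    exact hle _ _ (by linarith)
  have hint : IntervalIntegrable (deriv V) volume 0 1 :=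
    (hmono.monotoneOn _).intervalIntegrable_deriv
  have h1 : (C : ℝ) ≤ ∫ t in (0 : ℝ)..1, deriv V t := by
    have := intervalIntegral.integral_mono_ae (by norm_num : (0 : ℝ) ≤ 1)
      (intervalIntegrable_const (c := (C : ℝ))) hint hae
    simpa using this
  have h2 := (hmono.monotoneOn (uIcc 0 1)).intervalIntegral_deriv_mem_uIcc
  rw [uIcc_of_le (sub_nonneg.2 (hmono zero_le_one))] at h2
  have h3 : V 1 - V 0 = (length γ).toReal := by
    simp only [hV, variationOnFromTo.self, sub_zero, length]
    rw [variationOnFromTo.eq_of_le _ _ zero_le_one, univ_inter]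
  rw [← ENNReal.ofReal_coe_nnreal]
  refine ENNReal.ofReal_le_of_le_toReal ?_
  linarith [h2.2]

/-- A Lipschitz image of the line has Hausdorff dimension at most `1 < 2`. -/
theorem volume_range_eq_zero {K : ℝ≥0} {γ : UnitAddCircle → ℂ} (h : LipschitzWith K (lift γ)) :
    volume (range γ) = 0 := by
  rw [← range_lift]
  have h1 : dimH (range (lift γ)) ≤ 1 := by
    have := h.dimH_range_le
    rwa [Real.dimH_univ] at this
  have h2 : volume ≪ (μH[2] : Measure ℂ) := by
    have := isAddHaarMeasure_hausdorffMeasure (E := ℂ)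
    rw [Complex.finrank_real_complex] at this
    exact Measure.absolutelyContinuous_isAddHaarMeasure _ _
  exact measure_zero_of_dimH_lt (d := 2) (by exact_mod_cast h2) (h1.trans_lt (by norm_num))

/-! ### The energy controls oscillation of the velocity. -/

/-- The integrand of the nonlocal energy. -/
def energyDensity (s p : ℝ) (γ : UnitAddCircle → ℂ) (t t' : ℝ) : ℝ≥0∞ :=
  ‖tangent γ t - tangent γ t'‖ₑ ^ p / ‖lift γ t - lift γ t'‖ₑ ^ (1 + s * p)
      * ‖velocity γ t‖ₑ * ‖velocity γ t'‖ₑ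

theorem nonlocalEnergy_eq_lintegral (s p : ℝ) (γ : UnitAddCircle → ℂ) :
    nonlocalEnergy s p γ
      = ∫⁻ t in Ioc (0 : ℝ) 1, ∫⁻ t' in Ioc (0 : ℝ) 1, energyDensity s p γ t t' := rfl

theorem lintegral_energyDensity_eq (s p : ℝ) (γ : UnitAddCircle → ℂ) (t a : ℝ) :
    ∫⁻ t' in Ioc (0 : ℝ) 1, energyDensity s p γ t t'
      = ∫⁻ t' in Ioc a (a + 1), energyDensity s p γ t t' := by
  have hper : Function.Periodic (energyDensity s p γ t) 1 := fun t' => by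
    simp [energyDensity, tangent_add_one, lift_add_one, velocity_add_one]
  simpa using lintegral_Ioc_eq_of_periodic hper 0 a

theorem measurable_energyDensity (s p : ℝ) {γ : UnitAddCircle → ℂ} (hγ : Continuous (lift γ)) :
    Measurable fun q : ℝ × ℝ => energyDensity s p γ q.1 q.2 := by
  have h1 := measurable_velocity γ
  have h2 := measurable_tangent γ
  have h3 := hγ.measurable
  unfold energyDensity
  fun_prop

theorem measurable_energyDensity_right (s p : ℝ) {γ : UnitAddCircle → ℂ}
    (hγ : Continuous (lift γ)) (t : ℝ) : Measurable (energyDensity s p γ t) := by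
  have h1 := measurable_velocity γ
  have h2 := measurable_tangent γ
  have h3 := hγ.measurable
  unfold energyDensity
  fun_prop

/-- A substitute for Hölder's inequality: for `a ≥ r`, `a = a ^ (1 - p) * a ^ p` and the first
factor is at most `r ^ (1 - p)`. The parameter `r` stays free, to be made small before `h`. -/
theorem le_add_rpow {p : ℝ} (hp : 1 ≤ p) {a r : ℝ} (ha : 0 ≤ a) (hr : 0 < r) :
    a ≤ r + r ^ (1 - p) * a ^ p := by
  rcases le_total a r with h | h
  · have : 0 ≤ r ^ (1 - p) * a ^ p := by positivity
    linarith
  · have ha' : 0 < a := hr.trans_le h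
    have h1 : a ^ (1 - p) ≤ r ^ (1 - p) := Real.rpow_le_rpow_of_nonpos hr h (by linarith)
    have h2 : a ^ (1 - p) * a ^ p = a := by
      rw [← Real.rpow_add ha']; simp
    have h3 : a ^ (1 - p) * a ^ p ≤ r ^ (1 - p) * a ^ p := by gcongr
    linarith

/-- Chords over times at most `h` apart are at most `C * h` long, so the kernel is bounded below
there; the power of `C` collects the factors from the tangents, the chord and the two speeds. -/
theorem ofReal_norm_velocity_sub_rpow_le {C : ℝ≥0} (hC : 0 < C) {γ : UnitAddCircle → ℂ}
    (hlip : LipschitzWith C (lift γ)) {s p : ℝ} (hs : 0 < s) (hp : 1 ≤ p) {h : ℝ} (hh : 0 < h)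
    {t t' : ℝ} (ht : ‖velocity γ t‖ = C) (ht' : ‖velocity γ t'‖ = C) (htt : |t - t'| ≤ h) :
    ENNReal.ofReal (‖velocity γ t - velocity γ t'‖ ^ p)
      ≤ ENNReal.ofReal (C ^ (p - 1 + s * p) * h ^ (1 + s * p)) * energyDensity s p γ t t' := by
  have hC' : (0 : ℝ) < C := by exact_mod_cast hC
  have hsp : 0 < 1 + s * p := by positivity
  have h1 : ‖tangent γ t - tangent γ t'‖ = ‖velocity γ t - velocity γ t'‖ / C := by
    rw [tangent, tangent, ht, ht', ← sub_div, norm_div]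
    simp
  have h2 : ‖lift γ t - lift γ t'‖ ≤ C * h := by
    rw [← dist_eq_norm]
    refine (hlip.dist_le_mul t t').trans ?_
    rw [Real.dist_eq]
    gcongr
  have h3 : ENNReal.ofReal ((‖velocity γ t - velocity γ t'‖ / C) ^ p / (C * h) ^ (1 + s * p) * C * C)
      ≤ energyDensity s p γ t t' := by
    have e1 : ‖velocity γ t‖ₑ = ENNReal.ofReal C := by rw [← ht, ofReal_norm]
    have e2 : ‖velocity γ t'‖ₑ = ENNReal.ofReal C := by rw [← ht', ofReal_norm]
    rw [energyDensity, e1, e2, ENNReal.ofReal_mul (by positivity), ENNReal.ofReal_mul (by positivity),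
      ENNReal.ofReal_div_of_pos (by positivity), ← ENNReal.ofReal_rpow_of_nonneg (by positivity) (by linarith),
      ← ENNReal.ofReal_rpow_of_nonneg (by positivity) hsp.le, ← h1, ofReal_norm]
    gcongr
    rw [← ofReal_norm]
    exact ENNReal.ofReal_le_ofReal h2
  refine le_trans (le_of_eq ?_) (mul_le_mul_right h3 _)
  rw [← ENNReal.ofReal_mul (by positivity)]
  congr 1
  rw [Real.div_rpow (by positivity) (by positivity), Real.mul_rpow (by positivity) (by positivity)]
  have h4 : (C : ℝ) ^ (p - 1 + s * p) * C * C = C ^ p * C ^ (1 + s * p) := by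
    rw [← Real.rpow_add hC', ← Real.rpow_add_one hC'.ne', ← Real.rpow_add_one hC'.ne']
    congr 1; ring
  have h5 : (C : ℝ) ^ p ≠ 0 := by positivity
  have h6 : (C : ℝ) ^ (1 + s * p) ≠ 0 := by positivity
  have h7 : h ^ (1 + s * p) ≠ 0 := by positivity
  field_simp
  rw [mul_assoc, mul_comm p s, ← h4]
  ring

/-- The left side is the norm of the average of `velocity γ t - velocity γ t'` over `t'` in `(t, t +
h]`, to which `le_add_rpow` applies pointwise. -/
theorem enorm_velocity_sub_quotient_le {C : ℝ≥0} (hC : 0 < C) {γ : UnitAddCircle → ℂ}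
    (hlip : LipschitzWith C (lift γ)) (hv : ∀ᵐ t, ‖velocity γ t‖ = C) {s p : ℝ} (hs : 0 < s)
    (hp : 1 ≤ p) {h : ℝ} (hh : 0 < h) (hh1 : h ≤ 1) {r : ℝ} (hr : 0 < r) {κ : ℝ≥0∞}
    (hκ : κ = ENNReal.ofReal (r ^ (1 - p) * (C ^ (p - 1 + s * p) * h ^ (1 + s * p))))
    {t : ℝ} (ht : ‖velocity γ t‖ = C) :
    ‖velocity γ t - (lift γ (t + h) - lift γ t) / h‖ₑ
      ≤ ENNReal.ofReal h⁻¹ * (ENNReal.ofReal r * ENNReal.ofReal h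
        + κ * ∫⁻ t' in Ioc (0 : ℝ) 1, energyDensity s p γ t t') := by
  have hmeas : Measurable fun t' => energyDensity s p γ t t' :=
    measurable_energyDensity_right s p hlip.continuous t
  have hbd : ∀ t, ‖velocity γ t‖ ≤ C := fun t => norm_deriv_le_of_lipschitz hlip
  have hint : IntervalIntegrable (velocity γ) volume t (t + h) := by
    refine (intervalIntegrable_const (c := (C : ℝ))).mono_fun
      (measurable_velocity γ).aestronglyMeasurable (Eventually.of_forall fun t => ?_)
    simpa using hbd t
  have e1 : velocity γ t - (lift γ (t + h) - lift γ t) / h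
      = (h : ℂ)⁻¹ * ∫ t' in t..(t + h), (velocity γ t - velocity γ t') := by
    rw [intervalIntegral.integral_sub intervalIntegrable_const hint]
    have := hlip.integral_deriv_eq_sub_complex t (t + h)
    rw [show (∫ t' in t..(t + h), velocity γ t') = lift γ (t + h) - lift γ t from this]
    have : (h : ℂ) ≠ 0 := by exact_mod_cast hh.ne'
    simp only [intervalIntegral.integral_const, add_sub_cancel_left, Complex.real_smul]
    field_simp
  rw [e1, enorm_mul]
  have e2 : ‖(h : ℂ)⁻¹‖ₑ = ENNReal.ofReal h⁻¹ := by
    rw [← ofReal_norm, norm_inv, Complex.norm_real, Real.norm_of_nonneg hh.le]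
  rw [e2]
  refine mul_le_mul_right ?_ _
  rw [intervalIntegral.integral_of_le (by linarith)]
  refine (enorm_integral_le_lintegral_enorm _).trans ?_
  calc ∫⁻ t' in Ioc t (t + h), ‖velocity γ t - velocity γ t'‖ₑ
      ≤ ∫⁻ t' in Ioc t (t + h), (ENNReal.ofReal r + κ * energyDensity s p γ t t') := by
        refine lintegral_mono_ae ?_
        rw [ae_restrict_iff' measurableSet_Ioc]
        filter_upwards [hv] with t' ht' hmem
        have hd : |t - t'| ≤ h := by
          rw [abs_le]; constructor <;> linarith [hmem.1, hmem.2]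
        rw [← ofReal_norm]
        refine (ENNReal.ofReal_le_ofReal (le_add_rpow hp (norm_nonneg _) hr)).trans ?_
        rw [ENNReal.ofReal_add hr.le (by positivity), ENNReal.ofReal_mul (by positivity), hκ,
          ENNReal.ofReal_mul (by positivity), mul_assoc]
        refine add_le_add le_rfl (mul_le_mul_right ?_ _)
        exact ofReal_norm_velocity_sub_rpow_le hC hlip hs hp hh ht ht' hd
    _ = ENNReal.ofReal r * ENNReal.ofReal h
        + κ * ∫⁻ t' in Ioc t (t + h), energyDensity s p γ t t' := by
        rw [lintegral_add_left measurable_const,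
          lintegral_const_mul _ hmeas]
        simp
    _ ≤ _ := by
        rw [lintegral_energyDensity_eq s p γ t t]
        have hsub : Ioc t (t + h) ⊆ Ioc t (t + 1) := Ioc_subset_Ioc_right (by linarith)
        exact add_le_add le_rfl (mul_le_mul_right (lintegral_mono_set hsub) _)

/-- The energy controls the distance in `L¹` between the velocity and difference quotients. -/
theorem lintegral_velocity_sub_quotient_le {C : ℝ≥0} (hC : 0 < C) {γ : UnitAddCircle → ℂ}
    (hlip : LipschitzWith C (lift γ)) (hv : ∀ᵐ t, ‖velocity γ t‖ = C) {s p : ℝ} (hs : 0 < s)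
    (hp : 1 ≤ p) {M : ℝ} (hM : C ≤ M) {h : ℝ} (hh : 0 < h) (hh1 : h ≤ 1) {r : ℝ} (hr : 0 < r) :
    ∫⁻ t in Ioc (0 : ℝ) 1, ‖velocity γ t - (lift γ (t + h) - lift γ t) / h‖ₑ
      ≤ ENNReal.ofReal r
        + ENNReal.ofReal (r ^ (1 - p) * M ^ (p - 1 + s * p) * h ^ (s * p)) * nonlocalEnergy s p γ := by
  set κ : ℝ≥0∞ := ENNReal.ofReal (r ^ (1 - p) * (C ^ (p - 1 + s * p) * h ^ (1 + s * p))) with hκ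
  have hC' : (0 : ℝ) < C := by exact_mod_cast hC
  have key : ∀ᵐ t, ‖velocity γ t - (lift γ (t + h) - lift γ t) / h‖ₑ
      ≤ ENNReal.ofReal h⁻¹ * (ENNReal.ofReal r * ENNReal.ofReal h
        + κ * ∫⁻ t' in Ioc (0 : ℝ) 1, energyDensity s p γ t t') := by
    filter_upwards [hv] with t ht
    exact enorm_velocity_sub_quotient_le hC hlip hv hs hp hh hh1 hr hκ ht
  refine (lintegral_mono_ae (ae_restrict_of_ae key)).trans ?_
  have hm : Measurable fun t => ∫⁻ t' in Ioc (0 : ℝ) 1, energyDensity s p γ t t' :=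
    (measurable_energyDensity s p hlip.continuous).lintegral_prod_right'
  rw [lintegral_const_mul _ (by fun_prop), lintegral_add_left measurable_const,
    lintegral_const_mul _ hm, ← nonlocalEnergy_eq_lintegral, mul_add]
  simp only [lintegral_const, restrict_apply_univ, Real.volume_Ioc, sub_zero,
    ENNReal.ofReal_one, mul_one]
  gcongr ?_ + ?_
  · rw [mul_left_comm, ← ENNReal.ofReal_mul (by positivity), inv_mul_cancel₀ hh.ne']
    simp
  · rw [← mul_assoc, hκ, ← ENNReal.ofReal_mul (by positivity)]
    refine mul_le_mul_left (ENNReal.ofReal_le_ofReal ?_) _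
    have e3 : h ^ (1 + s * p) = h * h ^ (s * p) := by rw [Real.rpow_add hh, Real.rpow_one]
    -- The exponent is nonnegative, so the speed can be replaced by a bound common to a whole
    -- sequence.
    have e4 : (C : ℝ) ^ (p - 1 + s * p) ≤ M ^ (p - 1 + s * p) :=
      Real.rpow_le_rpow hC'.le hM (by nlinarith [mul_pos hs (by linarith : 0 < p)])
    rw [e3]
    calc h⁻¹ * (r ^ (1 - p) * (C ^ (p - 1 + s * p) * (h * h ^ (s * p))))
        = r ^ (1 - p) * C ^ (p - 1 + s * p) * h ^ (s * p) := by field_simp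
      _ ≤ _ := by
        have : (0 : ℝ) ≤ M ^ (p - 1 + s * p) := Real.rpow_nonneg (hC'.le.trans hM) _
        gcongr

theorem norm_quotient_le {C : ℝ≥0} {f : ℝ → ℂ} (hf : LipschitzWith C f) {h : ℝ} (hh : 0 < h)
    (t : ℝ) : ‖(f (t + h) - f t) / h‖ ≤ C := by
  have := hf.dist_le_mul (t + h) t
  rw [dist_eq_norm, Real.dist_eq, add_sub_cancel_left, abs_of_pos hh] at this
  rw [norm_div, Complex.norm_real, Real.norm_of_nonneg hh.le, div_le_iff₀ hh]
  exact this

/-- If difference quotients approximate the derivatives of a sequence of Lipschitz functions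
uniformly in `L¹`, then pointwise convergence of the functions gives `L¹` convergence of the
derivatives. -/
theorem tendsto_lintegral_deriv_sub {f : ℕ → ℝ → ℂ} {g : ℝ → ℂ} {M : ℝ≥0}
    (hf : ∀ n, LipschitzWith M (f n)) (hg : LipschitzWith M g)
    (hfg : ∀ t, Tendsto (fun n => f n t) atTop (𝓝 (g t)))
    (hunif : ∀ e : ℝ≥0∞, 0 < e → ∃ h₀ : ℝ, 0 < h₀ ∧ ∀ h, 0 < h → h < h₀ → ∀ n,
      ∫⁻ t in Ioc (0 : ℝ) 1, ‖deriv (f n) t - (f n (t + h) - f n t) / h‖ₑ ≤ e) :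
    Tendsto (fun n => ∫⁻ t in Ioc (0 : ℝ) 1, ‖deriv (f n) t - deriv g t‖ₑ) atTop (𝓝 0) := by
  rw [ENNReal.tendsto_nhds_zero]
  intro e he
  have he3 : 0 < e / 3 := ENNReal.div_pos he.ne' (by norm_num)
  have hcont : ∀ h, Continuous fun t => (g (t + h) - g t) / (h : ℂ) := fun h => by
    have := hg.continuous
    fun_prop
  have hcontf : ∀ n h, Continuous fun t => (f n (t + h) - f n t) / (h : ℂ) := fun n h => by
    have := (hf n).continuous
    fun_prop
  obtain ⟨h₀, hh₀, H1⟩ := hunif (e / 3) he3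
  have H2 : Tendsto (fun k : ℕ => ∫⁻ t in Ioc (0 : ℝ) 1,
      ‖(g (t + ((k : ℝ) + 1)⁻¹) - g t) / (((k : ℝ) + 1)⁻¹ : ℝ) - deriv g t‖ₑ) atTop (𝓝 0) := by
    have := tendsto_lintegral_of_dominated_convergence' (μ := volume.restrict (Ioc (0 : ℝ) 1))
      (F := fun (k : ℕ) t => ‖(g (t + ((k : ℝ) + 1)⁻¹) - g t) / (((k : ℝ) + 1)⁻¹ : ℝ) - deriv g t‖ₑ)
      (f := fun _ => 0) (fun _ => ENNReal.ofReal (M + M)) ?_ ?_ ?_ ?_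
    · simpa using this
    · intro k
      exact ((hcont _).measurable.sub (measurable_deriv g)).enorm.aemeasurable
    · intro k
      refine Eventually.of_forall fun t => ?_
      beta_reduce
      rw [← ofReal_norm]
      refine ENNReal.ofReal_le_ofReal ((norm_sub_le _ _).trans ?_)
      exact add_le_add (norm_quotient_le hg (by positivity) t) (norm_deriv_le_of_lipschitz hg)
    · simp
    · refine ae_restrict_of_ae ?_
      filter_upwards [hg.ae_differentiableAt_real] with t ht
      have hseq : Tendsto (fun k : ℕ => ((k : ℝ) + 1)⁻¹) atTop (𝓝[>] 0) := by
        refine tendsto_nhdsWithin_iff.2 ⟨?_, Eventually.of_forall fun k => by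
          simp only [mem_Ioi]; positivity⟩
        simpa [one_div] using tendsto_one_div_add_atTop_nhds_zero_nat (𝕜 := ℝ)
      have h1 := ht.hasDerivAt.tendsto_slope_zero_right.comp hseq
      have h2 := (tendsto_iff_norm_sub_tendsto_zero.1 h1)
      have h3 := ENNReal.tendsto_ofReal h2
      rw [ENNReal.ofReal_zero] at h3
      refine h3.congr fun k => ?_
      rw [ofReal_norm]
      simp only [Function.comp, Complex.real_smul, div_eq_inv_mul, Complex.ofReal_inv]
  have hseq : Tendsto (fun k : ℕ => ((k : ℝ) + 1)⁻¹) atTop (𝓝 0) := by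
    simpa [one_div] using tendsto_one_div_add_atTop_nhds_zero_nat (𝕜 := ℝ)
  -- The step `h` is fixed first, good for all `f n` and for `g`; only then does `n` grow.
  obtain ⟨k, hk1, hk2⟩ := ((hseq.eventually (gt_mem_nhds hh₀)).and
    ((ENNReal.tendsto_nhds_zero.1 H2) _ he3)).exists
  set h : ℝ := ((k : ℝ) + 1)⁻¹ with hh
  have hpos : 0 < h := by positivity
  have H3 : Tendsto (fun n : ℕ => ∫⁻ t in Ioc (0 : ℝ) 1,
      ‖(f n (t + h) - f n t) / h - (g (t + h) - g t) / h‖ₑ) atTop (𝓝 0) := by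
    have := tendsto_lintegral_of_dominated_convergence' (μ := volume.restrict (Ioc (0 : ℝ) 1))
      (F := fun (n : ℕ) t => ‖(f n (t + h) - f n t) / h - (g (t + h) - g t) / h‖ₑ)
      (f := fun _ => 0) (fun _ => ENNReal.ofReal (M + M)) ?_ ?_ ?_ ?_
    · simpa using this
    · intro n
      exact ((hcontf n h).sub (hcont h)).measurable.enorm.aemeasurable
    · intro n
      refine Eventually.of_forall fun t => ?_
      beta_reduce
      rw [← ofReal_norm]
      refine ENNReal.ofReal_le_ofReal ((norm_sub_le _ _).trans ?_)
      exact add_le_add (norm_quotient_le (hf n) hpos t) (norm_quotient_le hg hpos t)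
    · simp
    · refine Eventually.of_forall fun t => ?_
      have h1 := ((hfg (t + h)).sub (hfg t)).div_const (h : ℂ)
      have h3 := ENNReal.tendsto_ofReal (tendsto_iff_norm_sub_tendsto_zero.1 h1)
      rw [ENNReal.ofReal_zero] at h3
      exact h3.congr fun n => ofReal_norm _
  filter_upwards [(ENNReal.tendsto_nhds_zero.1 H3) _ he3] with n hn
  calc ∫⁻ t in Ioc (0 : ℝ) 1, ‖deriv (f n) t - deriv g t‖ₑ
      ≤ ∫⁻ t in Ioc (0 : ℝ) 1, (‖deriv (f n) t - (f n (t + h) - f n t) / h‖ₑ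
        + (‖(f n (t + h) - f n t) / h - (g (t + h) - g t) / h‖ₑ
        + ‖(g (t + h) - g t) / h - deriv g t‖ₑ)) := by
        refine lintegral_mono fun t => ?_
        have : deriv (f n) t - deriv g t = (deriv (f n) t - (f n (t + h) - f n t) / h)
          + (((f n (t + h) - f n t) / h - (g (t + h) - g t) / h)
          + ((g (t + h) - g t) / h - deriv g t)) := by ring
        rw [this]
        exact (enorm_add_le _ _).trans (by gcongr; exact enorm_add_le _ _)
    _ ≤ e / 3 + (e / 3 + e / 3) := by
        have m1 : Measurable fun t => ‖deriv (f n) t - (f n (t + h) - f n t) / h‖ₑ :=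
          ((measurable_deriv _).sub (hcontf n h).measurable).enorm
        have m2 : Measurable fun t => ‖(f n (t + h) - f n t) / h - (g (t + h) - g t) / h‖ₑ :=
          ((hcontf n h).sub (hcont h)).measurable.enorm
        rw [lintegral_add_left m1, lintegral_add_left m2]
        exact add_le_add (H1 h hpos hk1 n) (add_le_add hn hk2)
    _ = e := by rw [← add_assoc]; exact ENNReal.add_thirds e

/-- Shifting one representative by the integer nearest to the difference realises the circle
distance on the line. -/
theorem lipschitzWith_of_lift {K : ℝ≥0} {γ : UnitAddCircle → ℂ} (h : LipschitzWith K (lift γ)) :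
    LipschitzWith K γ := by
  refine LipschitzWith.of_dist_le_mul fun x y => ?_
  obtain ⟨b, rfl⟩ := QuotientAddGroup.mk_surjective y
  obtain ⟨a, rfl⟩ := QuotientAddGroup.mk_surjective x
  have h1 : dist (a : UnitAddCircle) (b : UnitAddCircle) = |a - b - round (a - b)| := by
    rw [dist_eq_norm, ← AddCircle.coe_sub, UnitAddCircle.norm_eq]
  have h2 : γ (a : UnitAddCircle) = lift γ (a - round (a - b)) := by
    have : ((round (a - b) : ℝ) : UnitAddCircle) = 0 := by
      rw [AddCircle.coe_eq_zero_iff]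
      exact ⟨round (a - b), by simp⟩
    simp [lift, this]
  have h3 := h.dist_le_mul (a - round (a - b)) b
  rw [← h2, Real.dist_eq] at h3
  refine h3.trans (le_of_eq ?_)
  rw [show dist (QuotientAddGroup.mk a : UnitAddCircle) (QuotientAddGroup.mk b)
    = dist (a : UnitAddCircle) (b : UnitAddCircle) from rfl, h1]
  ring_nf

/-! ### Winding numbers and enclosed area under convergence. -/

theorem norm_windingNumber_le {C d : ℝ} {γ : UnitAddCircle → ℂ} (hC : ∀ t, ‖velocity γ t‖ ≤ C)
    (hd : 0 < d) {z : ℂ} (hz : ∀ t, d ≤ ‖lift γ t - z‖) :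
    ‖windingNumber γ z‖ ≤ (2 * Real.pi)⁻¹ * (C / d) := by
  have hC0 : 0 ≤ C := (norm_nonneg _).trans (hC 0)
  have h1 : ‖∫ t in (0 : ℝ)..1, velocity γ t / (lift γ t - z)‖ ≤ C / d * |1 - 0| := by
    refine intervalIntegral.norm_integral_le_of_norm_le_const fun t _ => ?_
    rw [norm_div]
    exact div_le_div₀ hC0 (hC t) hd (hz t)
  rw [windingNumber, norm_mul]
  have h2 : ‖(2 * (Real.pi : ℂ) * Complex.I)⁻¹‖ = (2 * Real.pi)⁻¹ := by
    simp [abs_of_pos Real.pi_pos]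
  rw [h2]
  have := Real.pi_pos
  gcongr
  simpa using h1

theorem exists_pos_le_norm_lift_sub {γ : UnitAddCircle → ℂ} (hγ : Continuous γ) {z : ℂ}
    (hz : z ∉ range γ) : ∃ d : ℝ, 0 < d ∧ ∀ θ, d ≤ ‖γ θ - z‖ := by
  have hcl : IsClosed (range γ) := (isCompact_range hγ).isClosed
  obtain ⟨d, hd, hb⟩ := Metric.isOpen_iff.1 hcl.isOpen_compl z hz
  refine ⟨d, hd, fun θ => ?_⟩
  by_contra! hlt
  exact hb (by rwa [Metric.mem_ball, dist_eq_norm]) ⟨θ, rfl⟩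

/-- Uniform convergence keeps the curves at distance at least `d / 2` from `z`, so the integrands
are eventually dominated by a constant. -/
theorem tendsto_windingNumber {G : ℕ → UnitAddCircle → ℂ} {γ : UnitAddCircle → ℂ} {M : ℝ}
    (hG : ∀ n, Continuous (G n)) (hγ : Continuous γ) (hM : ∀ n t, ‖velocity (G n) t‖ ≤ M)
    (hunif : TendstoUniformly G γ atTop)
    (hv : ∀ᵐ t, Tendsto (fun n => velocity (G n) t) atTop (𝓝 (velocity γ t)))
    {z : ℂ} (hz : z ∉ range γ) :
    Tendsto (fun n => windingNumber (G n) z) atTop (𝓝 (windingNumber γ z)) := by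
  obtain ⟨d, hd, hdz⟩ := exists_pos_le_norm_lift_sub hγ hz
  have hev : ∀ᶠ n in atTop, ∀ θ, d / 2 ≤ ‖G n θ - z‖ := by
    filter_upwards [Metric.tendstoUniformly_iff.1 hunif (d / 2) (by positivity)] with n hn θ
    have h1 := hn θ
    rw [dist_eq_norm] at h1
    have h2 := norm_sub_le_norm_sub_add_norm_sub (γ θ) (G n θ) z
    linarith [hdz θ]
  refine Tendsto.const_mul _ ?_
  have hM0 : 0 ≤ M := (norm_nonneg _).trans (hM 0 0)
  refine intervalIntegral.tendsto_integral_filter_of_dominated_convergence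
    (fun _ => M / (d / 2)) ?_ ?_ intervalIntegrable_const ?_
  · refine Eventually.of_forall fun n => Measurable.aestronglyMeasurable ?_
    have h1 := measurable_velocity (G n)
    have h2 : Measurable (lift (G n)) := ((hG n).comp (AddCircle.continuous_mk' 1)).measurable
    fun_prop
  · filter_upwards [hev] with n hn
    refine Eventually.of_forall fun t _ => ?_
    rw [norm_div]
    exact div_le_div₀ hM0 (hM n t) (by positivity) (hn _)
  · filter_upwards [hv] with t ht _
    refine ht.div ((hunif.tendsto_at _).sub_const z) ?_
    exact norm_pos_iff.1 (hd.trans_le (hdz _))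

theorem measurable_windingNumber {γ : UnitAddCircle → ℂ} (hγ : Continuous γ) :
    Measurable (windingNumber γ) := by
  have h1 := measurable_velocity γ
  have h2 : Measurable (lift γ) := (hγ.comp (AddCircle.continuous_mk' 1)).measurable
  have h3 : StronglyMeasurable fun q : ℂ × ℝ => velocity γ q.2 / (lift γ q.2 - q.1) := by
    refine Measurable.stronglyMeasurable ?_
    fun_prop
  have h4 := (h3.integral_prod_right' (ν := volume.restrict (Ioc (0 : ℝ) 1))).measurable
  unfold windingNumber
  simp only [intervalIntegral.integral_of_le zero_le_one]
  exact h4.const_mul _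

theorem measurableSet_interior {γ : UnitAddCircle → ℂ} (hγ : Continuous γ) :
    MeasurableSet (interior γ) :=
  (isCompact_range hγ).isClosed.measurableSet.compl.inter
    (measurable_windingNumber hγ (measurableSet_singleton 1))

/-- At distance at least `M` from the curve the winding number has modulus at most `1 / (2π) < 1`.
The common ball is what dominates the indicators of the interiors. -/
theorem interior_subset_closedBall {M R : ℝ} (hM0 : 0 < M) {γ : UnitAddCircle → ℂ}
    (hM : ∀ t, ‖velocity γ t‖ ≤ M) (hR : ∀ θ, ‖γ θ‖ ≤ R) :
    interior γ ⊆ Metric.closedBall 0 (R + M) := by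
  rintro z ⟨-, hz⟩
  rw [mem_closedBall_zero_iff]
  by_contra! hlt
  have h1 := norm_windingNumber_le hM hM0 (z := z) fun t => by
    have := norm_sub_norm_le z (lift γ t)
    rw [norm_sub_rev] at this
    have h2 : ‖lift γ t‖ ≤ R := hR _
    linarith
  rw [hz, norm_one, div_self hM0.ne', mul_one] at h1
  have h2 : (2 * Real.pi)⁻¹ < 1 := inv_lt_one_of_one_lt₀ (by linarith [Real.pi_gt_three])
  linarith

/-- Convergent sequences in `{0, 1}` are eventually constant, so off the null set `range γ` the
indicators of the interiors are eventually those of the limit. -/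
theorem tendsto_volume_interior {G : ℕ → UnitAddCircle → ℂ} {γ : UnitAddCircle → ℂ} {M R : ℝ}
    (hM0 : 0 < M) (hG : ∀ n, Continuous (G n)) {K : ℝ≥0} (hγ : LipschitzWith K γ)
    (hM : ∀ n t, ‖velocity (G n) t‖ ≤ M) (hR : ∀ n θ, ‖G n θ‖ ≤ R)
    (hunif : TendstoUniformly G γ atTop)
    (hv : ∀ᵐ t, Tendsto (fun n => velocity (G n) t) atTop (𝓝 (velocity γ t)))
    (hw : ∀ n z, z ∉ range (G n) → windingNumber (G n) z = 0 ∨ windingNumber (G n) z = 1) :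
    (∀ z, z ∉ range γ → windingNumber γ z = 0 ∨ windingNumber γ z = 1) ∧
    Tendsto (fun n => volume (interior (G n))) atTop (𝓝 (volume (interior γ))) := by
  have hoff : ∀ z, z ∉ range γ → ∀ᶠ n in atTop, z ∉ range (G n) := by
    intro z hz
    obtain ⟨d, hd, hdz⟩ := exists_pos_le_norm_lift_sub hγ.continuous hz
    filter_upwards [Metric.tendstoUniformly_iff.1 hunif d hd] with n hn
    rintro ⟨θ, rfl⟩
    have := hn θ
    rw [dist_eq_norm] at this
    linarith [hdz θ]
  have hlim : ∀ z, z ∉ range γ →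
      Tendsto (fun n => windingNumber (G n) z) atTop (𝓝 (windingNumber γ z)) := fun z hz =>
    tendsto_windingNumber hG hγ.continuous hM hunif hv hz
  have h01 : ∀ z, z ∉ range γ → windingNumber γ z = 0 ∨ windingNumber γ z = 1 := by
    intro z hz
    have hcl : IsClosed ({0, 1} : Set ℂ) := (Set.toFinite _).isClosed
    have := hcl.mem_of_tendsto (hlim z hz) ((hoff z hz).mono fun n hn => hw n z hn)
    simpa using this
  refine ⟨h01, ?_⟩
  refine tendsto_measure_of_ae_tendsto_indicator atTop (measurableSet_interior hγ.continuous)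
    (fun n => measurableSet_interior (hG n))
    (measurableSet_closedBall (x := (0 : ℂ)) (ε := R + M)) (measure_closedBall_lt_top).ne
    (Eventually.of_forall fun n => interior_subset_closedBall hM0 (hM n) (hR n)) ?_
  have hnull : ∀ᵐ z : ℂ, z ∉ range γ :=
    measure_eq_zero_iff_ae_notMem.1 (volume_range_eq_zero (lipschitzWith_lift hγ))
  filter_upwards [hnull] with z hz
  have hnear := Metric.tendsto_nhds.1 (hlim z hz) 1 one_pos
  filter_upwards [hoff z hz, hnear] with n hn hd
  have e : windingNumber (G n) z = windingNumber γ z := by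
    rcases hw n z hn with h1 | h1 <;> rcases h01 z hz with h2 | h2 <;> rw [h1, h2] at hd ⊢ <;>
      simp at hd
  exact ⟨fun h => ⟨hz, e ▸ h.2⟩, fun h => ⟨hn, e.trans h.2⟩⟩

/-! ### Lower semicontinuity and closedness of the admissible class. -/

theorem energyDensity_le_liminf {G : ℕ → UnitAddCircle → ℂ} {γ : UnitAddCircle → ℂ} {s p : ℝ}
    (hs : 0 < s) (hp : 1 ≤ p) {t t' : ℝ}
    (hG : ∀ t, Tendsto (fun n => lift (G n) t) atTop (𝓝 (lift γ t)))
    (ht : Tendsto (fun n => velocity (G n) t) atTop (𝓝 (velocity γ t)))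
    (ht' : Tendsto (fun n => velocity (G n) t') atTop (𝓝 (velocity γ t')))
    (h0 : velocity γ t ≠ 0) (h0' : velocity γ t' ≠ 0) :
    energyDensity s p γ t t' ≤ liminf (fun n => energyDensity s p (G n) t t') atTop := by
  have hτ : ∀ t, velocity γ t ≠ 0 → Tendsto (fun n => velocity (G n) t) atTop (𝓝 (velocity γ t)) →
      Tendsto (fun n => tangent (G n) t) atTop (𝓝 (tangent γ t)) := by
    intro t h0 ht
    refine ht.div ?_ (by simpa using h0)
    exact (Complex.continuous_ofReal.tendsto _).comp ht.norm
  have hp0 : 0 < p := by linarith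
  have hsp : 0 < 1 + s * p := by positivity
  have h1 : Tendsto (fun n => ‖tangent (G n) t - tangent (G n) t'‖ₑ ^ p) atTop
      (𝓝 (‖tangent γ t - tangent γ t'‖ₑ ^ p)) :=
    ((ENNReal.continuous_rpow_const).tendsto _).comp ((hτ t h0 ht).sub (hτ t' h0' ht')).enorm
  have h2 : Tendsto (fun n => ‖lift (G n) t - lift (G n) t'‖ₑ ^ (1 + s * p)) atTop
      (𝓝 (‖lift γ t - lift γ t'‖ₑ ^ (1 + s * p))) :=
    ((ENNReal.continuous_rpow_const).tendsto _).comp ((hG t).sub (hG t')).enorm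
  -- The limit curve may intersect itself. With equal tangents the limit density is `0`, even as `0
  -- / 0`; otherwise the numerator is nonzero and the quotient converges in `ℝ≥0∞`, with limit `⊤`
  -- if the chord vanishes.
  by_cases hzero : ‖tangent γ t - tangent γ t'‖ₑ ^ p = 0
  · simp [energyDensity, hzero]
  · refine le_of_eq (Tendsto.liminf_eq ?_).symm
    have h3 := ENNReal.Tendsto.div h1 (Or.inl hzero) h2
      (Or.inr (ENNReal.rpow_ne_top_of_nonneg hp0.le enorm_ne_top))
    have h4 := ENNReal.Tendsto.mul h3 (Or.inr enorm_ne_top) ht.enorm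
      (Or.inl (by simpa using h0))
    exact ENNReal.Tendsto.mul h4 (Or.inr enorm_ne_top) ht'.enorm (Or.inl (by simpa using h0'))

theorem nonlocalEnergy_le_liminf {G : ℕ → UnitAddCircle → ℂ} {γ : UnitAddCircle → ℂ} {s p : ℝ}
    (hs : 0 < s) (hp : 1 ≤ p) (hcont : ∀ n, Continuous (lift (G n)))
    (hG : ∀ t, Tendsto (fun n => lift (G n) t) atTop (𝓝 (lift γ t)))
    (hv : ∀ᵐ t, Tendsto (fun n => velocity (G n) t) atTop (𝓝 (velocity γ t)))
    (h0 : ∀ᵐ t, velocity γ t ≠ 0) :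
    nonlocalEnergy s p γ ≤ liminf (fun n => nonlocalEnergy s p (G n)) atTop := by
  simp only [nonlocalEnergy_eq_lintegral]
  refine le_trans (lintegral_mono_ae ?_) (lintegral_liminf_le fun n =>
    (measurable_energyDensity s p (hcont n)).lintegral_prod_right')
  refine ae_restrict_of_ae ?_
  filter_upwards [hv, h0] with t ht h0t
  refine le_trans (lintegral_mono_ae ?_) (lintegral_liminf_le fun n =>
    measurable_energyDensity_right s p (hcont n) t)
  refine ae_restrict_of_ae ?_
  filter_upwards [hv, h0] with t' ht' h0t'
  exact energyDensity_le_liminf hs hp hG ht ht' h0t h0t'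

/-- The limit of converging admissible curves of converging energy is admissible, and its energy
does not exceed the limit of the energies. -/
theorem mem_admissible_and_totalEnergy_le_of_tendsto {ε : ℝ} (hε : 0 < ε) {N : ℕ} {x : Fin N → ℂ}
    {δ s p : ℝ} (hs : 0 < s) (hp : 1 ≤ p) {G : ℕ → UnitAddCircle → ℂ}
    {γ : UnitAddCircle → ℂ} {c : ℕ → ℝ≥0} {c₀ M : ℝ≥0} {I : ℝ≥0∞}
    (hG : ∀ n, G n ∈ admissible ε x) (hM : ∀ n, c n ≤ M)
    (hlip : ∀ n, LipschitzWith (c n) (G n)) (hc : ∀ n, ∀ᵐ t, ‖velocity (G n) t‖ = c n)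
    (hcc : Tendsto c atTop (𝓝 c₀)) (hunif : TendstoUniformly G γ atTop)
    (hv : ∀ᵐ t, Tendsto (fun n => velocity (G n) t) atTop (𝓝 (velocity γ t)))
    (hI : Tendsto (fun n => totalEnergy δ s p (G n)) atTop (𝓝 I)) :
    γ ∈ admissible ε x ∧ totalEnergy δ s p γ ≤ I := by
  have hpt : ∀ θ, Tendsto (fun n => G n θ) atTop (𝓝 (γ θ)) := hunif.tendsto_at
  have hγ : LipschitzWith c₀ γ := by
    refine LipschitzWith.of_dist_le_mul fun a b => ?_
    refine le_of_tendsto_of_tendsto ((hpt a).dist (hpt b))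
      (((NNReal.continuous_coe.tendsto _).comp hcc).mul_const _)
      (Eventually.of_forall fun n => (hlip n).dist_le_mul a b)
  have hvM : ∀ n t, ‖velocity (G n) t‖ ≤ M := fun n t =>
    (norm_deriv_le_of_lipschitz (lipschitzWith_lift (hlip n))).trans (hM n)
  obtain ⟨R, hR⟩ : ∃ R : ℝ, ∀ n θ, ‖G n θ‖ ≤ R := by
    obtain ⟨R, hR⟩ := (Metric.isBounded_range_of_tendsto _ (hpt 0)).exists_norm_le
    refine ⟨R + M * (1 / 2), fun n θ => ?_⟩
    have h1 := (hlip n).dist_le_mul θ 0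
    have h2 : dist θ 0 ≤ 1 / 2 := by
      have := AddCircle.norm_le_half_period 1 one_ne_zero (x := θ)
      rw [dist_zero_right]
      simpa using this
    have h3 : ‖G n 0‖ ≤ R := hR _ ⟨n, rfl⟩
    have h4 : (c n : ℝ) * dist θ 0 ≤ M * (1 / 2) := by
      have : (c n : ℝ) ≤ M := hM n
      gcongr
    have h5 := norm_le_norm_add_norm_sub' (G n θ) (G n 0)
    rw [dist_eq_norm] at h1
    linarith
  have hspeed : ∀ᵐ t, ‖velocity γ t‖ = c₀ := by
    filter_upwards [hv, ae_all_iff.2 hc] with t ht hct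
    refine tendsto_nhds_unique ht.norm ?_
    simp only [hct]
    exact (NNReal.continuous_coe.tendsto _).comp hcc
  obtain ⟨h01, hvol⟩ := tendsto_volume_interior (M := M + 1) (R := R) (by positivity)
    (fun n => (hlip n).continuous) hγ (fun n t => (hvM n t).trans (by linarith)) hR hunif hv
    (fun n => (hG n).2.2.1)
  have hvol' : volume (interior γ) = ENNReal.ofReal ε := by
    refine tendsto_nhds_unique hvol ?_
    simp only [(hG _).2.2.2.1]
    exact tendsto_const_nhds
  -- With zero speed all winding numbers would be `0` and the interior empty, against its area `ε >
  -- 0`.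
  have hc₀ : 0 < c₀ := by
    rw [pos_iff_ne_zero]
    rintro rfl
    have hz : ∀ z, windingNumber γ z = 0 := by
      intro z
      have : ∫ t in (0 : ℝ)..1, velocity γ t / (lift γ t - z) = 0 := by
        refine intervalIntegral.integral_zero_ae ?_
        filter_upwards [hspeed] with t ht _
        rw [norm_eq_zero.1 ht, zero_div]
      rw [windingNumber, this, mul_zero]
    have hempty : interior γ = ∅ := by
      refine eq_empty_of_forall_notMem fun z hz' => ?_
      have := hz'.2
      rw [hz] at this
      exact zero_ne_one this
    rw [hempty, measure_empty] at hvol'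
    exact (ENNReal.ofReal_pos.2 hε).ne hvol'
  have hc₀' : (0 : ℝ) < c₀ := hc₀
  refine ⟨⟨⟨_, hγ⟩, ?_, h01, hvol', c₀, hc₀, hspeed⟩, ?_⟩
  · intro i
    rw [← (isCompact_range hγ.continuous).isClosed.closure_eq, Metric.mem_closure_iff]
    intro e he
    obtain ⟨n, hn⟩ := (Metric.tendstoUniformly_iff.1 hunif e he).exists
    obtain ⟨θ, hθ⟩ := (hG n).2.1 i
    refine ⟨γ θ, ⟨θ, rfl⟩, ?_⟩
    rw [← hθ, dist_comm]
    exact hn θ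
  · have hlen : ∀ n, length (G n) = c n := fun n =>
      le_antisymm (length_le (lipschitzWith_lift (hlip n)))
        (le_length (lipschitzWith_lift (hlip n)) (hc n))
    have hcE : Tendsto (fun n => (c n : ℝ≥0∞)) atTop (𝓝 c₀) :=
      (ENNReal.continuous_coe.tendsto _).comp hcc
    have hcI : (c₀ : ℝ≥0∞) ≤ I := by
      refine le_of_tendsto_of_tendsto' hcE hI fun n => ?_
      rw [totalEnergy, hlen]
      exact le_self_add
    -- The lengths converge to the finite limit `c₀`, so the nonlocal parts converge too and the
    -- liminf bound loses nothing.
    have hsub : Tendsto (fun n => ENNReal.ofReal δ * nonlocalEnergy s p (G n)) atTop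
        (𝓝 (I - c₀)) := by
      refine (ENNReal.Tendsto.sub hI hcE (Or.inr ENNReal.coe_ne_top)).congr fun n => ?_
      rw [totalEnergy, hlen, ENNReal.add_sub_cancel_left ENNReal.coe_ne_top]
    have hE := nonlocalEnergy_le_liminf hs hp
      (fun n => (lipschitzWith_lift (hlip n)).continuous) (fun t => hpt _) hv
      (hspeed.mono fun t ht => norm_pos_iff.1 (by rw [ht]; exact hc₀'))
    have hE' : ENNReal.ofReal δ * nonlocalEnergy s p γ ≤ I - c₀ := by
      rw [← hsub.liminf_eq, ENNReal.liminf_const_mul_of_ne_top ENNReal.ofReal_ne_top]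
      gcongr
    calc totalEnergy δ s p γ ≤ c₀ + (I - c₀) := by
          rw [totalEnergy]
          exact add_le_add (length_le (lipschitzWith_lift hγ)) hE'
      _ = I := add_tsub_cancel_of_le hcI

/-! ### Compactness and the direct method. -/

/-- Curves of bounded energy that converge uniformly have a subsequence whose velocities converge
almost everywhere. -/
theorem exists_subseq_tendsto_velocity {s p : ℝ} (hs : 0 < s) (hp : 1 ≤ p)
    {G : ℕ → UnitAddCircle → ℂ} {γ : UnitAddCircle → ℂ} {c : ℕ → ℝ≥0} {M B : ℝ≥0}
    (hM : ∀ n, c n ≤ M) (hc0 : ∀ n, 0 < c n)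
    (hlip : ∀ n, LipschitzWith (c n) (G n)) (hc : ∀ n, ∀ᵐ t, ‖velocity (G n) t‖ = c n)
    (hγ : LipschitzWith M γ) (hpt : ∀ θ, Tendsto (fun n => G n θ) atTop (𝓝 (γ θ)))
    (hB : ∀ n, nonlocalEnergy s p (G n) ≤ B) :
    ∃ φ : ℕ → ℕ, StrictMono φ ∧
      ∀ᵐ t, Tendsto (fun n => velocity (G (φ n)) t) atTop (𝓝 (velocity γ t)) := by
  have hL1 := tendsto_lintegral_deriv_sub (f := fun n => lift (G n)) (g := lift γ) (M := M)
    (fun n => lipschitzWith_lift ((hlip n).weaken (hM n))) (lipschitzWith_lift hγ)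
    (fun t => hpt _) ?_
  · have hmeas : TendstoInMeasure (volume.restrict (Ioc (0 : ℝ) 1))
        (fun n => velocity (G n)) atTop (velocity γ) := by
      refine tendstoInMeasure_of_tendsto_eLpNorm one_ne_zero
        (fun n => (measurable_velocity _).aestronglyMeasurable)
        (measurable_velocity _).aestronglyMeasurable ?_
      simp only [eLpNorm_one_eq_lintegral_enorm]
      exact hL1
    obtain ⟨φ, hφ, hae⟩ := hmeas.exists_seq_tendsto_ae
    refine ⟨φ, hφ, ae_of_ae_Ioc (fun t => ?_) hae⟩
    simp only [velocity_add_one]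
  · intro e he
    have hsp : 0 < s * p := by positivity
    -- First `r` makes the first term of the `L¹` bound at most `e / 2`; with `r` fixed, small `h`
    -- handles the second.
    obtain ⟨r, hr0, hre⟩ : ∃ r : ℝ, 0 < r ∧ ENNReal.ofReal r ≤ e / 2 := by
      obtain ⟨r, h1, h2⟩ := ENNReal.lt_iff_exists_nnreal_btwn.1 (ENNReal.half_pos he.ne')
      refine ⟨r, by exact_mod_cast h1, ?_⟩
      rw [ENNReal.ofReal_coe_nnreal]
      exact h2.le
    have hlim : Tendsto (fun h : ℝ => ENNReal.ofReal (r ^ (1 - p) * M ^ (p - 1 + s * p)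
        * h ^ (s * p)) * B) (𝓝 0) (𝓝 0) := by
      have h1 : Tendsto (fun h : ℝ => r ^ (1 - p) * M ^ (p - 1 + s * p) * h ^ (s * p)) (𝓝 0)
          (𝓝 (r ^ (1 - p) * M ^ (p - 1 + s * p) * 0 ^ (s * p))) :=
        ((Real.continuous_rpow_const hsp.le).tendsto 0).const_mul _
      rw [Real.zero_rpow hsp.ne', mul_zero] at h1
      have h2 := ENNReal.Tendsto.mul_const (ENNReal.tendsto_ofReal h1)
        (Or.inr (ENNReal.coe_ne_top (r := B)))
      simpa using h2
    obtain ⟨h₀, hh₀, hball⟩ := Metric.eventually_nhds_iff.1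
      ((ENNReal.tendsto_nhds_zero.1 hlim) _ (ENNReal.half_pos he.ne'))
    refine ⟨min h₀ 1, by positivity, fun h hh hlt n => ?_⟩
    refine (lintegral_velocity_sub_quotient_le (hc0 n) (lipschitzWith_lift (hlip n)) (hc n) hs hp
      (M := M) (hM n) hh (hlt.le.trans (min_le_right _ _)) hr0).trans ?_
    have hb := hball (y := h) (by
      rw [Real.dist_eq, sub_zero, abs_of_pos hh]; exact hlt.trans_le (min_le_left _ _))
    calc _ ≤ e / 2 + e / 2 := by
          refine add_le_add hre (le_trans ?_ hb)
          gcongr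
          exact hB n
      _ = e := ENNReal.add_halves e

/-- The Arzelà-Ascoli theorem for closed curves. -/
theorem exists_subseq_tendstoUniformly {G : ℕ → UnitAddCircle → ℂ} {c : ℕ → ℝ≥0} {M : ℝ≥0} {R : ℝ}
    (hM : ∀ n, c n ≤ M) (hlip : ∀ n, LipschitzWith (c n) (G n)) (hR : ∀ n θ, ‖G n θ‖ ≤ R) :
    ∃ (φ : ℕ → ℕ) (γ : UnitAddCircle → ℂ) (c₀ : ℝ≥0), StrictMono φ ∧
      TendstoUniformly (fun n => G (φ n)) γ atTop ∧ Tendsto (fun n => c (φ n)) atTop (𝓝 c₀) := by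
  let F : ℕ → BoundedContinuousFunction UnitAddCircle ℂ := fun n =>
    BoundedContinuousFunction.mkOfCompact ⟨G n, (hlip n).continuous⟩
  have hcomp : IsCompact (closure (range F)) := by
    refine BoundedContinuousFunction.arzela_ascoli (Metric.closedBall 0 R)
      (isCompact_closedBall _ _) (range F) ?_ ?_
    · rintro f θ ⟨n, rfl⟩
      simpa [F] using hR n θ
    · refine (LipschitzWith.uniformEquicontinuous _ M ?_).equicontinuous
      rintro ⟨f, n, rfl⟩
      exact (hlip n).weaken (hM n)
  -- Compactness of the product extracts one subsequence for curves and speeds together.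
  have hcomp2 := hcomp.prod (isCompact_Icc (a := (0 : ℝ≥0)) (b := M))
  obtain ⟨⟨f, c₀⟩, -, φ, hφ, hlim⟩ := hcomp2.tendsto_subseq (x := fun n => (F n, c n))
    (fun n => ⟨subset_closure ⟨n, rfl⟩, zero_le, hM n⟩)
  rw [Prod.tendsto_iff] at hlim
  exact ⟨φ, f, c₀, hφ, BoundedContinuousFunction.tendsto_iff_tendstoUniformly.1 hlim.1, hlim.2⟩

/-- If some admissible curve has finite energy, then the energy attains its minimum. -/
theorem exists_minimizer {ε : ℝ} (hε : 0 < ε) {N : ℕ} (hN : 0 < N) {x : Fin N → ℂ} {δ s p : ℝ}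
    (hδ : 0 < δ) (hs : 0 < s) (hp : 1 ≤ p)
    (hfin : ∃ γ ∈ admissible ε x, totalEnergy δ s p γ < ⊤) :
    ∃ γ ∈ admissible ε x, totalEnergy δ s p γ < ⊤ ∧
      ∀ γ' ∈ admissible ε x, totalEnergy δ s p γ ≤ totalEnergy δ s p γ' := by
  obtain ⟨γ₁, hγ₁, hγ₁fin⟩ := hfin
  set E := totalEnergy δ s p '' admissible ε x with hE
  set I := sInf E with hI
  have hI1 : I < ⊤ := (sInf_le (mem_image_of_mem _ hγ₁)).trans_lt hγ₁fin
  have hne : E.Nonempty := ⟨_, γ₁, hγ₁, rfl⟩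
  obtain ⟨u, -, hu, huE⟩ := exists_seq_tendsto_sInf hne (OrderBot.bddBelow E)
  obtain ⟨B, hB⟩ := ENNReal.lt_iff_exists_nnreal_btwn.1 hI1
  obtain ⟨n₀, hn₀⟩ := eventually_atTop.1 (hu.eventually (gt_mem_nhds hB.1))
  choose G₀ hG₀ hGu₀ using huE
  -- Dropping the first `n₀` terms makes the energy bound `B` hold for every index.
  let G : ℕ → UnitAddCircle → ℂ := fun n => G₀ (n + n₀)
  have hG : ∀ n, G n ∈ admissible ε x := fun n => hG₀ _
  have hGI : Tendsto (fun n => totalEnergy δ s p (G n)) atTop (𝓝 I) := by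
    simp only [G, hGu₀]
    exact (tendsto_add_atTop_iff_nat n₀).2 hu
  have hGB : ∀ n, totalEnergy δ s p (G n) ≤ B := fun n => by
    simp only [G, hGu₀]
    exact (hn₀ _ (Nat.le_add_left _ _)).le
  have hcex : ∀ n, ∃ c : ℝ≥0, 0 < c ∧ LipschitzWith c (G n) ∧ ∀ᵐ t, ‖velocity (G n) t‖ = c := by
    intro n
    obtain ⟨⟨K, hK⟩, -, -, -, C, hC, hCae⟩ := hG n
    lift C to ℝ≥0 using hC.le
    exact ⟨C, hC, lipschitzWith_of_lift (lipschitzWith_of_ae_norm_deriv_le (lipschitzWith_lift hK)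
      (hCae.mono fun t ht => ht.le)), hCae⟩
  choose c hc0 hlip hc using hcex
  have hcB : ∀ n, c n ≤ B := fun n => by
    have h1 := le_length (lipschitzWith_lift (hlip n)) (hc n)
    have h2 : length (G n) ≤ totalEnergy δ s p (G n) := le_self_add
    exact_mod_cast h1.trans (h2.trans (hGB n))
  -- Every curve passes through the same point, and circle distances are at most `1 / 2`.
  have hR : ∀ n θ, ‖G n θ‖ ≤ ‖x ⟨0, hN⟩‖ + B * (1 / 2) := by
    intro n θ
    obtain ⟨θ', hθ'⟩ := (hG n).2.1 ⟨0, hN⟩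
    have h1 := (hlip n).dist_le_mul θ θ'
    have h2 : dist θ θ' ≤ 1 / 2 := by
      have := AddCircle.norm_le_half_period 1 one_ne_zero (x := θ - θ')
      rw [dist_eq_norm]
      simpa using this
    have h4 : (c n : ℝ) * dist θ θ' ≤ B * (1 / 2) := by
      have : (c n : ℝ) ≤ B := hcB n
      gcongr
    have h5 := norm_le_norm_add_norm_sub' (G n θ) (G n θ')
    rw [dist_eq_norm] at h1
    rw [← hθ']
    linarith
  obtain ⟨φ, γ, c₀, hφ, hunif, hcc⟩ := exists_subseq_tendstoUniformly hcB hlip hR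
  have hγ : LipschitzWith B γ := by
    refine LipschitzWith.of_dist_le_mul fun a b => ?_
    exact le_of_tendsto ((hunif.tendsto_at a).dist (hunif.tendsto_at b))
      (Eventually.of_forall fun n => ((hlip _).weaken (hcB _)).dist_le_mul a b)
  have hδ0 : ENNReal.ofReal δ ≠ 0 := (ENNReal.ofReal_pos.2 hδ).ne'
  have hEB : ∀ n, nonlocalEnergy s p (G n) ≤ (B / δ.toNNReal : ℝ≥0) := fun n => by
    have h1 : ENNReal.ofReal δ * nonlocalEnergy s p (G n) ≤ B :=
      le_trans le_add_self (hGB n)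
    rw [ENNReal.coe_div (Real.toNNReal_pos.2 hδ).ne', show ((δ.toNNReal : ℝ≥0) : ℝ≥0∞) = ENNReal.ofReal δ from rfl,
      ENNReal.le_div_iff_mul_le (Or.inl hδ0) (Or.inl ENNReal.ofReal_ne_top), mul_comm]
    exact h1
  obtain ⟨ψ, hψ, hv⟩ := exists_subseq_tendsto_velocity hs hp (G := fun n => G (φ n))
    (fun n => hcB (φ n)) (fun n => hc0 _) (fun n => hlip _) (fun n => hc _) hγ hunif.tendsto_at
    (fun n => hEB _)
  obtain ⟨hadm, hle⟩ := mem_admissible_and_totalEnergy_le_of_tendsto hε (δ := δ) hs hp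
    (G := fun n => G (φ (ψ n))) (c := fun n => c (φ (ψ n))) (I := I)
    (fun n => hG _) (fun n => hcB _) (fun n => hlip _) (fun n => hc _)
    (hcc.comp hψ.tendsto_atTop)
    (fun u hu => hψ.tendsto_atTop.eventually (hunif u hu)) hv
    (hGI.comp (hφ.tendsto_atTop.comp hψ.tendsto_atTop))
  exact ⟨γ, hadm, hle.trans_lt hI1, fun γ' hγ' => hle.trans (sInf_le (mem_image_of_mem _ hγ'))⟩

/-! ### A squared radius with prescribed values and integral. -/

theorem arg_exp_ofReal_mul_I {θ : ℝ} (hθ : θ ∈ Ioc (-Real.pi) Real.pi) :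
    (Complex.exp (θ * Complex.I)).arg = θ := by
  rw [Complex.arg_exp_mul_I]
  refine (toIocMod_eq_self _).2 ⟨hθ.1, ?_⟩
  linarith [hθ.2]

theorem exists_exp_notMem (U : Finset ℂ) :
    ∃ θ ∈ Ioc (-Real.pi) Real.pi, Complex.exp (θ * Complex.I) ∉ U := by
  by_contra! h
  have hinj : InjOn (fun θ : ℝ => Complex.exp (θ * Complex.I)) (Ioc (-Real.pi) Real.pi) := by
    intro a ha b hb hab
    rw [← arg_exp_ofReal_mul_I ha, ← arg_exp_ofReal_mul_I hb]
    exact congrArg _ hab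
  exact (infinite_of_injOn_mapsTo hinj (t := (U : Set ℂ)) h
    (Ioc_infinite (by linarith [Real.pi_pos]))) U.finite_toSet

/-- A nonnegative function that peaks at `u` and vanishes at the other points of `U`. -/
def peak (U : Finset ℂ) (k : ℕ) (u z : ℂ) : ℝ :=
  ((1 - ‖z - u‖ ^ 2 / 4) ^ 2) ^ k * ∏ v ∈ U.erase u, ‖z - v‖ ^ 2 / ‖u - v‖ ^ 2

theorem contDiff_norm_sub_sq (u : ℂ) : ContDiff ℝ ∞ fun z : ℂ => ‖z - u‖ ^ 2 :=
  (contDiff_id.sub contDiff_const).norm_sq ℝ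

theorem contDiff_peak (U : Finset ℂ) (k : ℕ) (u : ℂ) : ContDiff ℝ ∞ (peak U k u) := by
  unfold peak
  refine ContDiff.mul ?_ ?_
  · exact ((contDiff_const.sub ((contDiff_norm_sub_sq u).div_const _)).pow _).pow _
  · exact contDiff_prod fun v _ => (contDiff_norm_sub_sq v).div_const _

/-- The inner square in `peak` covers `‖z - u‖ > 2`: the profile must be positive on all of `ℂ` for
its square root to be smooth. -/
theorem peak_nonneg (U : Finset ℂ) (k : ℕ) (u z : ℂ) : 0 ≤ peak U k u z := by
  unfold peak
  positivity

theorem peak_self (U : Finset ℂ) (k : ℕ) (u : ℂ) : peak U k u u = 1 := by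
  unfold peak
  rw [Finset.prod_congr rfl (g := fun _ => (1 : ℝ))]
  · simp
  · intro v hv
    have : u - v ≠ 0 := sub_ne_zero.2 (Finset.ne_of_mem_erase hv).symm
    exact div_self (by positivity)

theorem peak_of_ne {U : Finset ℂ} (k : ℕ) {u v : ℂ} (hv : v ∈ U) (h : v ≠ u) :
    peak U k u v = 0 := by
  unfold peak
  rw [Finset.prod_eq_zero (Finset.mem_erase.2 ⟨h, hv⟩) (by simp), mul_zero]

/-- On the unit circle `1 - ‖z - u‖ ^ 2 / 4` lies in `[0, 1]` and equals `1` only at `u`, so its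
powers tend to `0` almost everywhere, dominated by the product factor. -/
theorem tendsto_integral_peak (U : Finset ℂ) {u : ℂ} (hu : ‖u‖ = 1) :
    Tendsto (fun k => ∫ θ : ℝ in (-Real.pi)..Real.pi, peak U k u (Complex.exp (θ * Complex.I)))
      atTop (𝓝 0) := by
  set P : ℝ → ℝ := fun θ =>
    ∏ v ∈ U.erase u, ‖Complex.exp (θ * Complex.I) - v‖ ^ 2 / ‖u - v‖ ^ 2 with hP
  have hPc : Continuous P := by fun_prop
  have hb : ∀ θ : ℝ, 1 - ‖Complex.exp (θ * Complex.I) - u‖ ^ 2 / 4 ∈ Icc (0 : ℝ) 1 := by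
    intro θ
    have h1 : ‖Complex.exp (θ * Complex.I) - u‖ ≤ 2 := by
      refine (norm_sub_le _ _).trans ?_
      rw [Complex.norm_exp_ofReal_mul_I, hu]; norm_num
    have h2 := norm_nonneg (Complex.exp (θ * Complex.I) - u)
    constructor <;> nlinarith
  have hsq : ∀ θ : ℝ, (1 - ‖Complex.exp (θ * Complex.I) - u‖ ^ 2 / 4) ^ 2 ≤ 1 := fun θ =>
    pow_le_one₀ (hb θ).1 (hb θ).2
  have hlim := intervalIntegral.tendsto_integral_filter_of_dominated_convergence (a := -Real.pi)
    (b := Real.pi) (μ := volume) (l := atTop)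
    (F := fun (k : ℕ) θ => peak U k u (Complex.exp (θ * Complex.I))) (f := fun _ => (0 : ℝ)) P
    ?_ ?_ (hPc.intervalIntegrable _ _) ?_
  · simpa using hlim
  · refine Eventually.of_forall fun k => Continuous.aestronglyMeasurable ?_
    exact (contDiff_peak U k u).continuous.comp (by fun_prop)
  · refine Eventually.of_forall fun k => Eventually.of_forall fun θ _ => ?_
    rw [Real.norm_of_nonneg (peak_nonneg _ _ _ _)]
    exact mul_le_of_le_one_left (by positivity) (pow_le_one₀ (sq_nonneg _) (hsq θ))
  · have hne : ∀ᵐ θ : ℝ, θ ≠ u.arg := by simp [ae_iff]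
    filter_upwards [hne] with θ hθ hmem
    rw [uIoc_of_le (by linarith [Real.pi_pos])] at hmem
    have hzu : Complex.exp (θ * Complex.I) - u ≠ 0 := by
      intro h0
      exact hθ (by rw [← arg_exp_ofReal_mul_I hmem, sub_eq_zero.1 h0])
    have hlt : (1 - ‖Complex.exp (θ * Complex.I) - u‖ ^ 2 / 4) ^ 2 < 1 := by
      have h1 : 0 < ‖Complex.exp (θ * Complex.I) - u‖ ^ 2 := by positivity
      exact pow_lt_one₀ (hb θ).1 (by linarith) two_ne_zero
    have := (tendsto_pow_atTop_nhds_zero_of_lt_one (sq_nonneg _) hlt).mul_const (P θ)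
    rwa [zero_mul] at this

/-- There is a smooth function, bounded below by a positive constant, with prescribed positive
values at finitely many points of the unit circle and prescribed integral over the circle. -/
theorem exists_radial_profile (U : Finset ℂ) (hU : ∀ u ∈ U, ‖u‖ = 1) (ρ : ℂ → ℝ)
    (hρ : ∀ u ∈ U, 0 < ρ u) {a : ℝ} (ha : 0 < a) :
    ∃ F : ℂ → ℝ, ContDiff ℝ ∞ F ∧ (∃ η, 0 < η ∧ ∀ z, η ≤ F z) ∧ (∀ u ∈ U, F u = ρ u) ∧
      ∫ θ : ℝ in (-Real.pi)..Real.pi, F (Complex.exp (θ * Complex.I)) = a := by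
  have hpi := Real.pi_pos
  obtain ⟨η, hη0, hηρ, hηa⟩ : ∃ η : ℝ, 0 < η ∧ (∀ u ∈ U, η ≤ ρ u) ∧ 2 * Real.pi * η < a := by
    have h1 : ∀ᶠ η in 𝓝[>] (0 : ℝ), ∀ u ∈ U, η ≤ ρ u :=
      (Finset.eventually_all U).2 fun u hu =>
        mem_nhdsWithin_of_mem_nhds ((gt_mem_nhds (hρ u hu)).mono fun _ h => h.le)
    have h2 : ∀ᶠ η in 𝓝[>] (0 : ℝ), η < a / (2 * Real.pi) :=
      mem_nhdsWithin_of_mem_nhds (gt_mem_nhds (by positivity))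
    obtain ⟨η, h1, h2, h3⟩ := (h1.and (h2.and self_mem_nhdsWithin)).exists
    refine ⟨η, h3, h1, ?_⟩
    rw [lt_div_iff₀ (by positivity)] at h2
    linarith
  -- `S k` already has the right values on `U`, and its integral tends to `2πη < a`; some `k` thus
  -- leaves a positive deficit.
  let S : ℕ → ℂ → ℝ := fun k z => η + ∑ u ∈ U, (ρ u - η) * peak U k u z
  have hS : ∀ k, ContDiff ℝ ∞ (S k) := fun k =>
    contDiff_const.add (ContDiff.sum fun u _ => contDiff_const.mul (contDiff_peak U k u))
  have hpc : ∀ k u, Continuous fun θ : ℝ => peak U k u (Complex.exp (θ * Complex.I)) :=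
    fun k u => (contDiff_peak U k u).continuous.comp (by fun_prop)
  have hSint : ∀ k, ∫ θ : ℝ in (-Real.pi)..Real.pi, S k (Complex.exp (θ * Complex.I))
      = 2 * Real.pi * η + ∑ u ∈ U, (ρ u - η) *
        ∫ θ : ℝ in (-Real.pi)..Real.pi, peak U k u (Complex.exp (θ * Complex.I)) := by
    intro k
    simp only [S]
    rw [intervalIntegral.integral_add intervalIntegrable_const
      ((continuous_finsetSum _ fun u _ => (hpc k u).const_mul _).intervalIntegrable _ _),
      intervalIntegral.integral_finsetSum
        fun u _ => ((hpc k u).const_mul _).intervalIntegrable _ _]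
    simp only [intervalIntegral.integral_const, intervalIntegral.integral_const_mul, smul_eq_mul]
    ring
  have hSlim : Tendsto (fun k => ∫ θ : ℝ in (-Real.pi)..Real.pi, S k (Complex.exp (θ * Complex.I)))
      atTop (𝓝 (2 * Real.pi * η)) := by
    simp only [hSint]
    have := (tendsto_finsetSum U fun u hu =>
      (tendsto_integral_peak U (hU u hu)).const_mul (ρ u - η)).const_add (2 * Real.pi * η)
    simpa using this
  obtain ⟨k, hk⟩ := (hSlim.eventually (gt_mem_nhds hηa)).exists
  -- A multiple of `P` makes up the deficit without disturbing the values on `U`, where `P`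
  -- vanishes.
  let P : ℂ → ℝ := fun z => ∏ u ∈ U, ‖z - u‖ ^ 2
  have hP : ContDiff ℝ ∞ P := contDiff_prod fun u _ => contDiff_norm_sub_sq u
  have hPc : Continuous fun θ : ℝ => P (Complex.exp (θ * Complex.I)) :=
    hP.continuous.comp (by fun_prop)
  have hP0 : ∀ z, 0 ≤ P z := fun z => Finset.prod_nonneg fun u _ => by positivity
  have hPint : 0 < ∫ θ : ℝ in (-Real.pi)..Real.pi, P (Complex.exp (θ * Complex.I)) := by
    obtain ⟨θ, hθ, hθU⟩ := exists_exp_notMem U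
    refine intervalIntegral.integral_pos (by linarith) hPc.continuousOn (fun _ _ => hP0 _)
      ⟨θ, Ioc_subset_Icc_self hθ, Finset.prod_pos fun u hu => ?_⟩
    have : Complex.exp (θ * Complex.I) - u ≠ 0 :=
      sub_ne_zero.2 fun h => hθU (h ▸ hu)
    positivity
  set A := ∫ θ : ℝ in (-Real.pi)..Real.pi, S k (Complex.exp (θ * Complex.I)) with hA
  set B := ∫ θ : ℝ in (-Real.pi)..Real.pi, P (Complex.exp (θ * Complex.I)) with hB
  have hm : 0 ≤ (a - A) / B := by
    have : 0 < a - A := by linarith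
    positivity
  refine ⟨fun z => S k z + (a - A) / B * P z, (hS k).add (contDiff_const.mul hP),
    ⟨η, hη0, fun z => ?_⟩, fun u hu => ?_, ?_⟩
  · have h1 : 0 ≤ ∑ u ∈ U, (ρ u - η) * peak U k u z :=
      Finset.sum_nonneg fun u hu => mul_nonneg (sub_nonneg.2 (hηρ u hu)) (peak_nonneg _ _ _ _)
    have h2 := mul_nonneg hm (hP0 z)
    simp only [S]
    linarith
  · have h1 : P u = 0 := Finset.prod_eq_zero hu (by simp)
    have h2 : ∑ v ∈ U, (ρ v - η) * peak U k v u = ρ u - η := by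
      rw [Finset.sum_eq_single u]
      · rw [peak_self, mul_one]
      · intro v _ hvu
        rw [peak_of_ne k hu hvu.symm, mul_zero]
      · exact fun h => absurd hu h
    simp only [S, h1, h2]
    ring
  · have hSc : Continuous fun θ : ℝ => S k (Complex.exp (θ * Complex.I)) :=
      (hS k).continuous.comp (by fun_prop)
    rw [intervalIntegral.integral_add (hSc.intervalIntegrable _ _)
      ((hPc.const_mul _).intervalIntegrable _ _), intervalIntegral.integral_const_mul, ← hA, ← hB,
      div_mul_cancel₀ _ hPint.ne']
    ring

/-! ### Arc-length reparametrisation and a criterion for finite energy. -/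

theorem exists_bounds_of_periodic {w : ℝ → ℝ} {T : ℝ} (hT : T ≠ 0) (hw : Continuous w)
    (hper : Function.Periodic w T) (hpos : ∀ θ, 0 < w θ) :
    ∃ a b, 0 < a ∧ ∀ θ, a ≤ w θ ∧ w θ ≤ b := by
  have hc := hper.compact_of_continuous hT hw
  obtain ⟨_, ⟨θ₁, rfl⟩, h1⟩ := hc.exists_isLeast (range_nonempty w)
  obtain ⟨b, hb⟩ := hc.bddAbove
  exact ⟨w θ₁, b, hpos _, fun θ => ⟨h1 ⟨θ, rfl⟩, hb ⟨θ, rfl⟩⟩⟩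

/-- Reparametrisation with prescribed periodic speed: the inverse of a primitive of `w`. -/
theorem exists_reparametrization {w : ℝ → ℝ} {T : ℝ} (hT : 0 < T) (hw : Continuous w)
    (hper : Function.Periodic w T) (hpos : ∀ θ, 0 < w θ) :
    ∃ (φ : ℝ → ℝ) (L : ℝ), 0 < L ∧ Function.Surjective φ ∧
      (∀ t, HasDerivAt φ (L / w (φ t)) t) ∧ ∀ t, φ (t + 1) = φ t + T := by
  set σ : ℝ → ℝ := fun θ => ∫ r in (0 : ℝ)..θ, w r with hσ
  have hint : ∀ a b, IntervalIntegrable w volume a b := fun a b => hw.intervalIntegrable a b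
  have hσd : ∀ θ, HasDerivAt σ (w θ) θ := fun θ =>
    intervalIntegral.integral_hasDerivAt_right (hint _ _)
      (hw.stronglyMeasurableAtFilter _ _) hw.continuousAt
  have hmono : StrictMono σ := strictMono_of_hasDerivAt_pos hσd hpos
  have hσc : Continuous σ := continuous_iff_continuousAt.2 fun θ => (hσd θ).continuousAt
  set L := ∫ r in (0 : ℝ)..T, w r with hL
  have hLpos : 0 < L := intervalIntegral.intervalIntegral_pos_of_pos (hint _ _) hpos hT
  have hσT : ∀ θ, σ (θ + T) = σ θ + L := by
    intro θ
    have h1 := intervalIntegral.integral_add_adjacent_intervals (hint 0 θ) (hint θ (θ + T))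
    have h2 := hper.intervalIntegral_add_eq θ 0
    rw [zero_add] at h2
    simp only [hσ]
    rw [← h1, h2]
  have hsurj : Function.Surjective σ := by
    refine hσc.surjective ?_ ?_
    · exact hper.tendsto_atTop_intervalIntegral_of_pos' (hint _ _) hpos hT
    · exact hper.tendsto_atBot_intervalIntegral_of_pos' (hint _ _) hpos hT
  let e := hmono.orderIsoOfSurjective σ hsurj
  have hσe : ∀ y, σ (e.symm y) = y := fun y => e.apply_symm_apply y
  have hed : ∀ y, HasDerivAt e.symm (w (e.symm y))⁻¹ y := fun y =>
    HasDerivAt.of_local_left_inverse e.symm.continuous.continuousAt (hσd _) (hpos _).ne'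
      (Eventually.of_forall hσe)
  refine ⟨fun t => e.symm (L * t), L, hLpos, fun θ => ⟨σ θ / L, ?_⟩, fun t => ?_, fun t => ?_⟩
  · apply hmono.injective
    rw [hσe]
    field_simp
  · have h1 := (hed (L * t)).comp t ((hasDerivAt_id t).const_mul L)
    refine h1.congr_deriv ?_
    rw [mul_one, div_eq_inv_mul]
  · apply hmono.injective
    rw [hσT, hσe, hσe]
    ring

theorem lintegral_Ioc_abs_rpow_lt_top {e : ℝ} (he : -1 < e) :
    ∫⁻ u in Ioc (-(1 / 2) : ℝ) (1 / 2), ENNReal.ofReal (|u| ^ e) < ⊤ := by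
  have h1 : IntervalIntegrable (fun u : ℝ => |u| ^ e) volume 0 (1 / 2) := by
    refine (intervalIntegral.intervalIntegrable_rpow' he).congr ?_
    intro u hu
    rw [uIoc_of_le (by norm_num)] at hu
    simp only [abs_of_pos hu.1]
  have h2 : IntervalIntegrable (fun u : ℝ => |u| ^ e) volume (-(1 / 2)) 0 := by
    have := (IntervalIntegrable.iff_comp_neg).1 h1
    simp only [abs_neg, neg_zero] at this
    exact this.symm
  have h3 := (intervalIntegrable_iff_integrableOn_Ioc_of_le (by norm_num)).1 (h2.trans h1)
  have h4 := h3.2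
  rw [hasFiniteIntegral_iff_ofReal (Eventually.of_forall fun u => by positivity)] at h4
  exact h4

/-- A curve that is bi-Lipschitz and has a Lipschitz tangent has finite energy. -/
theorem nonlocalEnergy_lt_top {s p : ℝ} (hs0 : 0 < s) (hs1 : s < 1) (hp : 1 ≤ p)
    {γ : UnitAddCircle → ℂ} {C A B : ℝ} (hC : ∀ t, ‖velocity γ t‖ ≤ C) (hA : 0 ≤ A) (hB : 0 < B)
    (hτ : ∀ t t', |t - t'| ≤ 1 / 2 → ‖tangent γ t - tangent γ t'‖ ≤ A * |t - t'|)
    (hγ : ∀ t t', |t - t'| ≤ 1 / 2 → B * |t - t'| ≤ ‖lift γ t - lift γ t'‖) :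
    nonlocalEnergy s p γ < ⊤ := by
  have hC0 : 0 ≤ C := (norm_nonneg _).trans (hC 0)
  have hp0 : 0 < p := by linarith
  have hsp : 0 < 1 + s * p := by positivity
  set e : ℝ := p - (1 + s * p) with he
  -- Since `e = p * (1 - s) - 1`, this is where `s < 1` enters.
  have he1 : -1 < e := by nlinarith
  set D : ℝ := A ^ p / B ^ (1 + s * p) * C * C with hD
  have hpt : ∀ t t', |t - t'| ≤ 1 / 2 → t ≠ t' →
      energyDensity s p γ t t' ≤ ENNReal.ofReal D * ENNReal.ofReal (|t' - t| ^ e) := by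
    intro t t' h hne
    have hu : 0 < |t - t'| := abs_pos.2 (sub_ne_zero.2 hne)
    have hCe : ∀ t, ‖velocity γ t‖ₑ ≤ ENNReal.ofReal C := fun t => by
      rw [← ofReal_norm]; exact ENNReal.ofReal_le_ofReal (hC t)
    have h1 : ‖tangent γ t - tangent γ t'‖ₑ ^ p ≤ ENNReal.ofReal ((A * |t - t'|) ^ p) := by
      rw [← ENNReal.ofReal_rpow_of_nonneg (by positivity) hp0.le, ← ofReal_norm]
      exact ENNReal.rpow_le_rpow (ENNReal.ofReal_le_ofReal (hτ t t' h)) hp0.le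
    have h2 : ENNReal.ofReal ((B * |t - t'|) ^ (1 + s * p))
        ≤ ‖lift γ t - lift γ t'‖ₑ ^ (1 + s * p) := by
      rw [← ENNReal.ofReal_rpow_of_nonneg (by positivity) hsp.le, ← ofReal_norm]
      exact ENNReal.rpow_le_rpow (ENNReal.ofReal_le_ofReal (hγ t t' h)) hsp.le
    calc energyDensity s p γ t t'
        ≤ ENNReal.ofReal ((A * |t - t'|) ^ p) / ENNReal.ofReal ((B * |t - t'|) ^ (1 + s * p))
          * ENNReal.ofReal C * ENNReal.ofReal C :=
          mul_le_mul' (mul_le_mul' (ENNReal.div_le_div h1 h2) (hCe t)) (hCe t')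
      _ = ENNReal.ofReal D * ENNReal.ofReal (|t' - t| ^ e) := by
          rw [← ENNReal.ofReal_div_of_pos (by positivity), ← ENNReal.ofReal_mul (by positivity),
            ← ENNReal.ofReal_mul (by positivity), ← ENNReal.ofReal_mul (by positivity)]
          congr 1
          rw [abs_sub_comm t' t, he, Real.rpow_sub hu, Real.mul_rpow hA hu.le,
            Real.mul_rpow hB.le hu.le, hD]
          field_simp
  set J := ∫⁻ u in Ioc (-(1 / 2) : ℝ) (1 / 2), ENNReal.ofReal (|u| ^ e) with hJ
  have hinner : ∀ t, ∫⁻ t' in Ioc (0 : ℝ) 1, energyDensity s p γ t t' ≤ ENNReal.ofReal D * J := by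
    intro t
    -- On the period centred at `t` one has `|t - t'| ≤ 1 / 2`, the range of the hypotheses.
    rw [lintegral_energyDensity_eq s p γ t (t - 1 / 2)]
    calc ∫⁻ t' in Ioc (t - 1 / 2) (t - 1 / 2 + 1), energyDensity s p γ t t'
        ≤ ∫⁻ t' in Ioc (t - 1 / 2) (t - 1 / 2 + 1),
          ENNReal.ofReal D * ENNReal.ofReal (|t' - t| ^ e) := by
          refine lintegral_mono_ae ?_
          rw [ae_restrict_iff' measurableSet_Ioc]
          have hne : ∀ᵐ t' : ℝ, t' ≠ t := by simp [ae_iff]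
          filter_upwards [hne] with t' hne hmem
          exact hpt t t' (by rw [abs_le]; constructor <;> linarith [hmem.1, hmem.2]) hne.symm
      _ = ENNReal.ofReal D * ∫⁻ t' in Ioc (t - 1 / 2) (t - 1 / 2 + 1),
          ENNReal.ofReal (|t' - t| ^ e) := lintegral_const_mul _ (by fun_prop)
      _ = ENNReal.ofReal D * J := by
          congr 1
          have hmp := measurePreserving_sub_right (volume : Measure ℝ) t
          have hpre : (fun t' => t' - t) ⁻¹' Ioc (-(1 / 2) : ℝ) (1 / 2)
              = Ioc (t - 1 / 2) (t - 1 / 2 + 1) := by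
            ext t'
            simp only [mem_preimage, mem_Ioc]
            constructor <;> rintro ⟨h1, h2⟩ <;> constructor <;> linarith
          rw [hJ, ← hpre]
          exact hmp.setLIntegral_comp_preimage (f := fun u => ENNReal.ofReal (|u| ^ e))
            measurableSet_Ioc (by fun_prop)
  have hJfin : J < ⊤ := lintegral_Ioc_abs_rpow_lt_top he1
  rw [nonlocalEnergy_eq_lintegral]
  calc ∫⁻ t in Ioc (0 : ℝ) 1, ∫⁻ t' in Ioc (0 : ℝ) 1, energyDensity s p γ t t'
      ≤ ∫⁻ _ in Ioc (0 : ℝ) 1, ENNReal.ofReal D * J := lintegral_mono hinner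
    _ = ENNReal.ofReal D * J := by simp
    _ < ⊤ := ENNReal.mul_lt_top ENNReal.ofReal_lt_top hJfin

/-- Law of cosines: the squared distance is `(R - R') ^ 2 + 4 * R * R' * sin ((α - β) / 2) ^ 2`. -/
theorem norm_polar_sub_ge {m R R' α β : ℝ} (hm : 0 ≤ m) (hR : m ≤ R) (hR' : m ≤ R') :
    2 * m * |Real.sin ((α - β) / 2)|
      ≤ ‖(R : ℂ) * Complex.exp (α * Complex.I) - R' * Complex.exp (β * Complex.I)‖ := by
  refine abs_le_of_sq_le_sq' ?_ (norm_nonneg _) |>.2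
  rw [← Complex.normSq_eq_norm_sq, Complex.normSq_apply, mul_pow, sq_abs]
  simp only [Complex.sub_re, Complex.sub_im, Complex.re_ofReal_mul, Complex.im_ofReal_mul,
    Complex.exp_ofReal_mul_I_re, Complex.exp_ofReal_mul_I_im]
  have h1 : Real.cos α * Real.cos β + Real.sin α * Real.sin β
      = 1 - 2 * Real.sin ((α - β) / 2) ^ 2 := by
    rw [← Real.cos_sub, Real.sin_sq_eq_half_sub]
    ring_nf
  have h2 := Real.sin_sq_add_cos_sq α
  have h3 := Real.sin_sq_add_cos_sq β
  have h4 : (R * Real.cos α - R' * Real.cos β) * (R * Real.cos α - R' * Real.cos β)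
      + (R * Real.sin α - R' * Real.sin β) * (R * Real.sin α - R' * Real.sin β)
      = (R - R') ^ 2 + 4 * (R * R') * Real.sin ((α - β) / 2) ^ 2 := by
    linear_combination R ^ 2 * h2 + R' ^ 2 * h3 - 2 * R * R' * h1
  rw [h4]
  have h5 : m * m ≤ R * R' := mul_le_mul hR hR' hm (hm.trans hR)
  nlinarith [sq_nonneg (R - R'), sq_nonneg (Real.sin ((α - β) / 2))]

/-- Jordan's inequality `sin y ≥ 2 * y / π`, applied to `Δ / 2` or, past `π / 2`, to its reflection;
hence the bounds on both `Δ` and `2π - Δ`. -/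
theorem le_sin_half {κ u Δ : ℝ} (hκ : 0 ≤ κ) (hu0 : 0 ≤ u) (h1 : κ * u ≤ Δ)
    (h2 : κ * u ≤ 2 * Real.pi - Δ) : κ * u / Real.pi ≤ Real.sin (Δ / 2) := by
  have hpi := Real.pi_pos
  have h0 : 0 ≤ κ * u := by positivity
  have key : ∀ y, κ * u / 2 ≤ y → y ≤ Real.pi / 2 → κ * u / Real.pi ≤ Real.sin y := by
    intro y hy1 hy2
    have := Real.mul_le_sin (x := y) (by linarith) hy2
    refine le_trans ?_ this
    rw [div_mul_eq_mul_div, div_le_div_iff_of_pos_right hpi]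
    linarith
  rcases le_total (Δ / 2) (Real.pi / 2) with h | h
  · exact key _ (by linarith) h
  · rw [← Real.sin_pi_sub]
    exact key _ (by linarith) (by linarith)

/-! ### Winding numbers and area for star-shaped curves. -/

/-- The principal logarithm of `h` is a primitive of the integrand and takes equal values at both
ends. -/
theorem integral_deriv_div_eq_zero {h v : ℝ → ℂ} (hd : ∀ t, HasDerivAt h (v t) t)
    (hv : Continuous v) (hs : ∀ t, h t ∈ Complex.slitPlane) (h01 : h 0 = h 1) :
    ∫ t in (0 : ℝ)..1, v t / h t = 0 := by
  have hc : Continuous h := continuous_iff_continuousAt.2 fun t => (hd t).continuousAt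
  have h1 := intervalIntegral.integral_eq_sub_of_hasDerivAt (a := 0) (b := 1)
    (f := fun t => Complex.log (h t)) (f' := fun t => v t / h t)
    (fun t _ => (hd t).clog_real (hs t))
    ((hv.div hc fun t => Complex.slitPlane_ne_zero (hs t)).intervalIntegrable _ _)
  rw [h1, h01, sub_self]

/-- The slit-plane condition says that the curve avoids the ray starting at `z` and pointing away
from `c`. -/
theorem windingNumber_eq_zero_of_slitPlane {γ : UnitAddCircle → ℂ} {v : ℝ → ℂ} {c z : ℂ}
    (hd : ∀ t, HasDerivAt (lift γ) (v t) t) (hv : Continuous v) (hzc : z ≠ c)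
    (hs : ∀ t, 1 - (lift γ t - c) / (z - c) ∈ Complex.slitPlane) : windingNumber γ z = 0 := by
  have hzc' : z - c ≠ 0 := sub_ne_zero.2 hzc
  have h01 : lift γ 0 = lift γ 1 := by simpa using (lift_add_one γ 0).symm
  have h1 := integral_deriv_div_eq_zero (h := fun t => 1 - (lift γ t - c) / (z - c))
    (v := fun t => -(v t / (z - c)))
    (fun t => (((hd t).sub_const c).div_const (z - c)).const_sub 1)
    (hv.div_const _).neg hs (by simp only [h01])
  have h2 : ∀ t, velocity γ t / (lift γ t - z)
      = -(v t / (z - c)) / (1 - (lift γ t - c) / (z - c)) := by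
    intro t
    have h3 := Complex.slitPlane_ne_zero (hs t)
    have h4 : 1 - (lift γ t - c) / (z - c) = -(lift γ t - z) / (z - c) := by field_simp; ring
    have h5 : lift γ t - z ≠ 0 := by
      intro h0; rw [h4, h0] at h3; simp at h3
    rw [h4, velocity, (hd t).deriv]
    field_simp
  rw [windingNumber]
  simp only [h2]
  rw [h1, mul_zero]

/-- The slit-plane condition says that the curve avoids the segment from `c` to `z`; the logarithmic
derivative of the quotient is the difference of the two integrands. -/
theorem windingNumber_eq_of_slitPlane {γ : UnitAddCircle → ℂ} {v : ℝ → ℂ} {c z : ℂ}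
    (hd : ∀ t, HasDerivAt (lift γ) (v t) t) (hv : Continuous v) (hc : ∀ t, lift γ t ≠ c)
    (hs : ∀ t, (lift γ t - z) / (lift γ t - c) ∈ Complex.slitPlane) :
    windingNumber γ z = windingNumber γ c := by
  have hlc : Continuous (lift γ) := continuous_iff_continuousAt.2 fun t => (hd t).continuousAt
  have hc' : ∀ t, lift γ t - c ≠ 0 := fun t => sub_ne_zero.2 (hc t)
  have hz' : ∀ t, lift γ t - z ≠ 0 := by
    intro t h0
    have := Complex.slitPlane_ne_zero (hs t)
    simp [h0] at this
  have h01 : lift γ 0 = lift γ 1 := by simpa using (lift_add_one γ 0).symm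
  have h1 := integral_deriv_div_eq_zero (h := fun t => (lift γ t - z) / (lift γ t - c))
    (v := fun t => (v t * (lift γ t - c) - (lift γ t - z) * v t) / (lift γ t - c) ^ 2)
    (fun t => ((hd t).sub_const z).div ((hd t).sub_const c) (hc' t))
    (Continuous.div (by fun_prop) (by fun_prop) fun t => pow_ne_zero 2 (hc' t)) hs
    (by simp only [h01])
  have h2 : ∀ t, (v t * (lift γ t - c) - (lift γ t - z) * v t) / (lift γ t - c) ^ 2
      / ((lift γ t - z) / (lift γ t - c)) = v t / (lift γ t - z) - v t / (lift γ t - c) := by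
    intro t
    have := hc' t
    have := hz' t
    field_simp
  simp only [h2] at h1
  have hi1 : IntervalIntegrable (fun t => v t / (lift γ t - z)) volume 0 1 :=
    (hv.div (hlc.sub continuous_const) hz').intervalIntegrable _ _
  have hi2 : IntervalIntegrable (fun t => v t / (lift γ t - c)) volume 0 1 :=
    (hv.div (hlc.sub continuous_const) hc').intervalIntegrable _ _
  rw [intervalIntegral.integral_sub hi1 hi2, sub_eq_zero] at h1
  simp only [windingNumber, velocity, (hd _).deriv, h1]

/-- The function `log R + i φ` is a continuous logarithm of `lift γ - c`, and it gains `2πi` over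
one period. -/
theorem windingNumber_center {γ : UnitAddCircle → ℂ} {v : ℝ → ℂ} {c : ℂ} {R φ : ℝ → ℝ}
    (hd : ∀ t, HasDerivAt (lift γ) (v t) t) (hv : Continuous v) (hR : Differentiable ℝ R)
    (hφ : Differentiable ℝ φ) (hpos : ∀ t, 0 < R t)
    (hγ : ∀ t, lift γ t = c + R t * Complex.exp (φ t * Complex.I)) (hφ1 : φ 1 = φ 0 + 2 * Real.pi)
    (hR1 : R 1 = R 0) : windingNumber γ c = 1 := by
  have hlc : Continuous (lift γ) := continuous_iff_continuousAt.2 fun t => (hd t).continuousAt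
  set ψ : ℝ → ℂ := fun t => (Real.log (R t) : ℂ) + φ t * Complex.I with hψ
  have hexp : ∀ t, lift γ t - c = Complex.exp (ψ t) := by
    intro t
    rw [hγ, hψ, Complex.exp_add, ← Complex.ofReal_exp, Real.exp_log (hpos t)]
    ring
  have hne : ∀ t, lift γ t - c ≠ 0 := fun t => by rw [hexp]; exact Complex.exp_ne_zero _
  have hψd : ∀ t, HasDerivAt ψ (v t / (lift γ t - c)) t := by
    intro t
    have h1 : DifferentiableAt ℝ ψ t := by
      have h2 : DifferentiableAt ℝ (fun t => Real.log (R t)) t := (hR t).log (hpos t).ne'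
      exact (h2.hasDerivAt.ofReal_comp.add
        ((hφ t).hasDerivAt.ofReal_comp.mul_const _)).differentiableAt
    have h3 := h1.hasDerivAt.cexp
    have h4 : HasDerivAt (fun t => Complex.exp (ψ t)) (v t) t := by
      refine ((hd t).sub_const c).congr_of_eventuallyEq (Eventually.of_forall fun t => ?_)
      exact (hexp t).symm
    have h5 := h3.unique h4
    refine h1.hasDerivAt.congr_deriv ?_
    rw [eq_div_iff (hne t), hexp, mul_comm]
    exact h5
  have h1 := intervalIntegral.integral_eq_sub_of_hasDerivAt (a := 0) (b := 1) (fun t _ => hψd t)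
    ((hv.div (hlc.sub continuous_const) hne).intervalIntegrable _ _)
  have h2 : ψ 1 - ψ 0 = 2 * Real.pi * Complex.I := by
    simp only [hψ, hR1, hφ1]
    push_cast
    ring
  have h3 : (2 * (Real.pi : ℂ) * Complex.I) ≠ 0 := by
    simp [Real.pi_ne_zero]
  simp only [windingNumber, velocity, (hd _).deriv, h1, h2]
  exact inv_mul_cancel₀ h3

/-- The area of a star-shaped domain. -/
theorem volume_starShaped {Q : ℂ → ℝ} (hQ : Continuous Q) (hpos : ∀ z, 0 < Q z) (c : ℂ) :
    volume {z | ‖z - c‖ < Q ((z - c) / ‖z - c‖)}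
      = ENNReal.ofReal (∫ θ : ℝ in (-Real.pi)..Real.pi, Q (Complex.exp (θ * Complex.I)) ^ 2 / 2) := by
  set D : Set ℂ := {z | ‖z‖ < Q (z / ‖z‖)} with hD
  have hDm : MeasurableSet D := by
    have := hQ.measurable
    exact measurableSet_lt (by fun_prop) (by fun_prop)
  have htr : volume {z | ‖z - c‖ < Q ((z - c) / ‖z - c‖)} = volume D :=
    (measurePreserving_sub_right volume c).measure_preimage hDm.nullMeasurableSet
  have hEc : Continuous fun θ : ℝ => Complex.exp (θ * Complex.I) := by fun_prop
  have hin : ∀ R : ℝ, 0 < R →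
      ∫⁻ r in Ioi (0 : ℝ), (Iio R).indicator (fun r => ENNReal.ofReal r) r
        = ENNReal.ofReal (R ^ 2 / 2) := by
    intro R hR
    rw [lintegral_indicator measurableSet_Iio, Measure.restrict_restrict measurableSet_Iio,
      inter_comm, Ioi_inter_Iio, Measure.restrict_congr_set Ioo_ae_eq_Ioc, ← ofReal_integral_eq_lintegral_ofReal]
    · rw [← intervalIntegral.integral_of_le hR.le, integral_id]
      simp
    · exact (intervalIntegrable_iff_integrableOn_Ioc_of_le hR.le).1 intervalIntegral.intervalIntegrable_id
    · rw [EventuallyLE, ae_restrict_iff' measurableSet_Ioc]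
      exact Eventually.of_forall fun r hr => hr.1.le
  have hpi : -Real.pi ≤ Real.pi := by linarith [Real.pi_pos]
  have hQE : Continuous fun θ : ℝ => Q (Complex.exp (θ * Complex.I)) ^ 2 / 2 :=
    ((hQ.comp hEc).pow 2).div_const _
  have hmeas : MeasurableSet {q : ℝ × ℝ | q.1 < Q (Complex.exp (q.2 * Complex.I))} :=
    measurableSet_lt measurable_fst ((hQ.comp hEc).measurable.comp measurable_snd)
  rw [htr, ← lintegral_indicator_one hDm, ← Complex.lintegral_comp_polarCoord_symm,
    show polarCoord.target = Ioi (0 : ℝ) ×ˢ Ioo (-Real.pi) Real.pi from rfl]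
  have hcongr : ∫⁻ q in Ioi (0 : ℝ) ×ˢ Ioo (-Real.pi) Real.pi,
      ENNReal.ofReal q.1 • D.indicator 1 (Complex.polarCoord.symm q)
      = ∫⁻ q in Ioi (0 : ℝ) ×ˢ Ioo (-Real.pi) Real.pi,
        {q : ℝ × ℝ | q.1 < Q (Complex.exp (q.2 * Complex.I))}.indicator
          (fun q => ENNReal.ofReal q.1) q := by
    refine setLIntegral_congr_fun (measurableSet_Ioi.prod measurableSet_Ioo) fun q hq => ?_
    have hq0 : 0 < q.1 := hq.1
    have e1 : Complex.polarCoord.symm q = q.1 * Complex.exp (q.2 * Complex.I) := by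
      rw [Complex.polarCoord_symm_apply, Complex.exp_mul_I, Complex.ofReal_cos, Complex.ofReal_sin]
    have e2 : ‖Complex.polarCoord.symm q‖ = q.1 := by
      rw [Complex.norm_polarCoord_symm, abs_of_pos hq0]
    have e3 : Complex.polarCoord.symm q ∈ D ↔ q.1 < Q (Complex.exp (q.2 * Complex.I)) := by
      rw [hD, mem_ofPred_eq, e2, e1, mul_div_cancel_left₀]
      exact_mod_cast hq0.ne'
    by_cases h : q.1 < Q (Complex.exp (q.2 * Complex.I))
    · simp only [indicator_of_mem (e3.2 h), indicator_of_mem (show q ∈ {q : ℝ × ℝ |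
        q.1 < Q (Complex.exp (q.2 * Complex.I))} from h), Pi.one_apply, smul_eq_mul, mul_one]
    · simp only [indicator_of_notMem (mt e3.1 h), indicator_of_notMem (show q ∉ {q : ℝ × ℝ |
        q.1 < Q (Complex.exp (q.2 * Complex.I))} from h), smul_zero]
  rw [hcongr, Measure.volume_eq_prod, ← Measure.prod_restrict, lintegral_prod_symm]
  · have : ∀ θ : ℝ, ∫⁻ r in Ioi (0 : ℝ),
        {q : ℝ × ℝ | q.1 < Q (Complex.exp (q.2 * Complex.I))}.indicator
          (fun q => ENNReal.ofReal q.1) (r, θ)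
        = ENNReal.ofReal (Q (Complex.exp (θ * Complex.I)) ^ 2 / 2) := fun θ => by
      rw [← hin _ (hpos _)]
      rfl
    simp only [this]
    rw [Measure.restrict_congr_set Ioo_ae_eq_Ioc, ← ofReal_integral_eq_lintegral_ofReal,
      intervalIntegral.integral_of_le hpi]
    · exact (intervalIntegrable_iff_integrableOn_Ioc_of_le hpi).1 (hQE.intervalIntegrable _ _)
    · exact Eventually.of_forall fun θ => by positivity
  · exact ((measurable_fst.ennreal_ofReal).indicator hmeas).aemeasurable

theorem not_mem_slitPlane_iff {z : ℂ} : z ∉ Complex.slitPlane ↔ ∃ k : ℝ, 0 ≤ k ∧ z = -k := by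
  rw [Complex.mem_slitPlane_iff]
  push Not
  constructor
  · rintro ⟨h1, h2⟩
    exact ⟨-z.re, by linarith, Complex.ext (by simp) (by simp [h2])⟩
  · rintro ⟨k, hk, rfl⟩
    simp [hk]

/-- A curve that runs once around the star-shaped domain with radial function `Q`. -/
theorem interior_starShaped {γ : UnitAddCircle → ℂ} {v : ℝ → ℂ} {c : ℂ} {Q : ℂ → ℝ} {φ : ℝ → ℝ}
    (hd : ∀ t, HasDerivAt (lift γ) (v t) t) (hv : Continuous v) (hQ : ∀ z, 0 < Q z)
    (hφ : Differentiable ℝ φ) (hφs : Function.Surjective φ) (hφ1 : φ 1 = φ 0 + 2 * Real.pi)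
    (hR : Differentiable ℝ fun t => Q (Complex.exp (φ t * Complex.I)))
    (hγ : ∀ t, lift γ t = c + Q (Complex.exp (φ t * Complex.I)) * Complex.exp (φ t * Complex.I)) :
    (∀ z, ‖z - c‖ = Q ((z - c) / ‖z - c‖) → z ∈ range γ) ∧
    (∀ z, z ∉ range γ → windingNumber γ z = 0 ∨ windingNumber γ z = 1) ∧
    interior γ = {z | ‖z - c‖ < Q ((z - c) / ‖z - c‖)} := by
  set E : ℝ → ℂ := fun t => Complex.exp (φ t * Complex.I) with hE
  have hEn : ∀ t, ‖E t‖ = 1 := fun t => Complex.norm_exp_ofReal_mul_I _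
  have hE0 : ∀ t, E t ≠ 0 := fun t => Complex.exp_ne_zero _
  have hγ' : ∀ t, lift γ t - c = Q (E t) * E t := fun t => by rw [hγ]; ring
  have hQc : ∀ z, (Q z : ℂ) ≠ 0 := fun z => by exact_mod_cast (hQ z).ne'
  -- positive multiples of a point of the curve
  have hmul : ∀ (k : ℝ) t z, 0 < k → z - c = k * (lift γ t - c) →
      ‖z - c‖ = k * Q (E t) ∧ (z - c) / ‖z - c‖ = E t := by
    intro k t z hk hz
    have h1 : ‖z - c‖ = k * Q (E t) := by
      rw [hz, hγ', norm_mul, norm_mul, hEn, Complex.norm_real, Complex.norm_real,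
        Real.norm_of_nonneg hk.le, Real.norm_of_nonneg (hQ _).le, mul_one]
    refine ⟨h1, ?_⟩
    have hk' : (k : ℂ) ≠ 0 := by exact_mod_cast hk.ne'
    have := hQc (E t)
    rw [h1, hz, hγ']
    push_cast
    field_simp
  have hon : ∀ z, ‖z - c‖ = Q ((z - c) / ‖z - c‖) → z ∈ range γ := by
    intro z hz
    obtain ⟨t, ht⟩ := hφs (z - c).arg
    have hn : 0 < ‖z - c‖ := hz ▸ hQ _
    have hn' : (‖z - c‖ : ℂ) ≠ 0 := by exact_mod_cast hn.ne'
    have h1 := Complex.norm_mul_exp_arg_mul_I (z - c)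
    have h2 : E t = (z - c) / ‖z - c‖ := by
      simp only [hE, ht]
      rw [eq_div_iff hn', mul_comm]
      exact h1
    rw [← range_lift]
    refine ⟨t, ?_⟩
    rw [hγ]
    change c + Q (E t) * E t = z
    rw [h2, ← hz, mul_div_cancel₀ _ hn']
    ring
  have hoff : ∀ z, z ∈ range γ → ‖z - c‖ = Q ((z - c) / ‖z - c‖) := by
    intro z hz
    rw [← range_lift] at hz
    obtain ⟨t, rfl⟩ := hz
    obtain ⟨h1, h2⟩ := hmul 1 t (lift γ t) one_pos (by simp)
    rw [h2, h1, one_mul]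
  have hcne : ∀ t, lift γ t ≠ c := by
    intro t h0
    have := hγ' t
    rw [h0, sub_self] at this
    exact mul_ne_zero (hQc _) (hE0 _) this.symm
  have hctr : windingNumber γ c = 1 := by
    refine windingNumber_center (R := fun t => Q (E t)) hd hv hR hφ (fun t => hQ _) hγ hφ1 ?_
    have : E 1 = E 0 := by
      simp only [hE, hφ1]
      rw [Complex.exp_eq_exp_iff_exists_int]
      exact ⟨1, by push_cast; ring⟩
    simp only [this]
  have hin : ∀ z, ‖z - c‖ < Q ((z - c) / ‖z - c‖) → windingNumber γ z = 1 := by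
    intro z hz
    rw [windingNumber_eq_of_slitPlane hd hv hcne, hctr]
    intro t
    -- Otherwise `lift γ t` lies on the segment from `c` to `z`, so `z` has radius at least `Q` in
    -- its direction.
    by_contra hns
    obtain ⟨k, hk, hk2⟩ := not_mem_slitPlane_iff.1 hns
    rw [div_eq_iff (sub_ne_zero.2 (hcne t))] at hk2
    obtain ⟨h1, h2⟩ := hmul (1 + k) t z (by linarith) (by
      push_cast; linear_combination -hk2)
    rw [h2, h1] at hz
    nlinarith [hQ (E t)]
  have hout : ∀ z, Q ((z - c) / ‖z - c‖) < ‖z - c‖ → windingNumber γ z = 0 := by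
    intro z hz
    have hn : 0 < ‖z - c‖ := (hQ _).trans hz
    have hzc : z - c ≠ 0 := norm_pos_iff.1 hn
    refine windingNumber_eq_zero_of_slitPlane hd hv (sub_ne_zero.1 hzc) fun t => ?_
    by_contra hns
    obtain ⟨k, hk, hk2⟩ := not_mem_slitPlane_iff.1 hns
    have hk' : (1 + k : ℂ) ≠ 0 := by
      have : (1 + k : ℝ) ≠ 0 := by linarith
      exact_mod_cast this
    have hk3 : lift γ t - c = (1 + k) * (z - c) := by
      have h3 : (lift γ t - c) / (z - c) = 1 + k := by linear_combination -hk2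
      rw [← h3, div_mul_cancel₀ _ hzc]
    obtain ⟨h1, h2⟩ := hmul (1 + k)⁻¹ t z (by positivity) (by
      rw [hk3]; push_cast; field_simp)
    rw [h2, h1] at hz
    have h4 : (1 + k)⁻¹ ≤ 1 := inv_le_one_of_one_le₀ (by linarith)
    nlinarith [hQ (E t)]
  refine ⟨hon, fun z hz => ?_, ?_⟩
  · rcases lt_trichotomy ‖z - c‖ (Q ((z - c) / ‖z - c‖)) with h | h | h
    · exact Or.inr (hin z h)
    · exact absurd (hon z h) hz
    · exact Or.inl (hout z h)
  · ext z
    constructor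
    · rintro ⟨h1, h2⟩
      rcases lt_trichotomy ‖z - c‖ (Q ((z - c) / ‖z - c‖)) with h | h | h
      · exact h
      · exact absurd (hon z h) h1
      · rw [hout z h] at h2
        exact absurd h2 zero_ne_one
    · intro h
      exact ⟨fun hz => h.ne (hoff z hz), hin z h⟩

/-! ### The competitor of finite energy. -/

theorem deriv_periodic {f : ℝ → ℂ} {T : ℝ} (h : Function.Periodic f T) :
    Function.Periodic (deriv f) T := fun t => by
  rw [← deriv_comp_add_const, funext h]

theorem exists_lipschitz_of_periodic {f : ℝ → ℂ} {T : ℝ} (hT : T ≠ 0) (hf : ContDiff ℝ 1 f)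
    (h : Function.Periodic f T) : ∃ K : ℝ, 0 ≤ K ∧ ∀ a b, ‖f a - f b‖ ≤ K * |a - b| := by
  obtain ⟨K, hK⟩ := ((deriv_periodic h).comp norm).compact_of_continuous hT
    (hf.continuous_deriv le_rfl).norm |>.bddAbove
  have hK' : ∀ t, ‖deriv f t‖ ≤ K := fun t => hK ⟨t, rfl⟩
  refine ⟨K, (norm_nonneg _).trans (hK' 0), fun a b => ?_⟩
  exact convex_univ.norm_image_sub_le_of_norm_deriv_le
    (fun t _ => hf.differentiable one_ne_zero t) (fun t _ => hK' t) (mem_univ b) (mem_univ a)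

/-- A point from which given points are seen in different directions. -/
theorem exists_center {N : ℕ} (x : Fin N → ℂ) : ∃ c : ℂ, (∀ i, x i ≠ c) ∧
    ∀ i j, (x i - c) / ‖x i - c‖ = (x j - c) / ‖x j - c‖ → x i = x j := by
  have hnull : volume (⋃ q : Fin N × Fin N, (affineSpan ℝ {x q.1, x q.2} : Set ℂ)) = 0 := by
    refine measure_iUnion_null fun q => Measure.addHaar_affineSubspace _ _ fun htop => ?_
    have h1 := collinear_iff_finrank_le_one.1 (collinear_pair ℝ (x q.1) (x q.2))
    rw [← direction_affineSpan, htop, AffineSubspace.direction_top, finrank_top,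
      Complex.finrank_real_complex] at h1
    omega
  obtain ⟨c, hc⟩ : ∃ c, c ∉ ⋃ q : Fin N × Fin N, (affineSpan ℝ {x q.1, x q.2} : Set ℂ) := by
    by_contra! h
    rw [eq_univ_of_forall h, measure_univ_of_isAddLeftInvariant] at hnull
    exact ENNReal.top_ne_zero hnull
  simp only [mem_iUnion, not_exists] at hc
  have hne : ∀ i, x i ≠ c := fun i h => hc (i, i) (h ▸ left_mem_affineSpan_pair ℝ (x i) (x i))
  refine ⟨c, hne, fun i j hij => ?_⟩
  by_contra hxx
  have hα : (‖x i - c‖ : ℂ) ≠ 0 := by simpa [sub_eq_zero] using hne i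
  have hβ : (‖x j - c‖ : ℂ) ≠ 0 := by simpa [sub_eq_zero] using hne j
  rw [div_eq_div_iff hα hβ] at hij
  have hαβ : (‖x j - c‖ : ℂ) - ‖x i - c‖ ≠ 0 := by
    intro h
    rw [sub_eq_zero.1 h] at hij
    exact hxx (by linear_combination mul_right_cancel₀ hα hij)
  refine hc (i, j) ?_
  -- With `α`, `β` the distances of `x i`, `x j` from `c`, equal directions give `β * (x i - c) = α
  -- * (x j - c)`; solving for `c` yields this affine parameter.
  have hmem := AffineMap.lineMap_mem_affineSpan_pair (-‖x i - c‖ / (‖x j - c‖ - ‖x i - c‖) : ℝ)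
    (x i) (x j)
  convert! hmem using 1
  rw [AffineMap.lineMap_apply_module']
  simp only [Complex.real_smul]
  push_cast
  field_simp
  linear_combination -hij

/-- The star-shaped curve with a given smooth radial function is, after reparametrisation by arc
length, admissible and of finite energy. -/
theorem exists_finite_energy_of_profile {ε δ s p : ℝ} (hs0 : 0 < s) (hs1 : s < 1)
    (hp : 1 ≤ p) {N : ℕ} {x : Fin N → ℂ} {c : ℂ} {F : ℂ → ℝ} (hF : ContDiff ℝ ∞ F) {η : ℝ}
    (hη : 0 < η) (hFη : ∀ z, η ≤ F z)
    (hFint : ∫ θ : ℝ in (-Real.pi)..Real.pi, F (Complex.exp (θ * Complex.I)) = 2 * ε)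
    (hFx : ∀ i, F ((x i - c) / ‖x i - c‖) = ‖x i - c‖ ^ 2) :
    ∃ γ ∈ admissible ε x, totalEnergy δ s p γ < ⊤ := by
  have hpi := Real.pi_pos
  have hFpos : ∀ z, 0 < F z := fun z => hη.trans_le (hFη z)
  -- `F` is the squared radius, which makes the area constraint linear in `F`.
  set Q : ℂ → ℝ := fun z => √(F z) with hQ
  have hQpos : ∀ z, 0 < Q z := fun z => Real.sqrt_pos.2 (hFpos z)
  have hQm : ∀ z, √η ≤ Q z := fun z => Real.sqrt_le_sqrt (hFη z)
  have hm : 0 < √η := Real.sqrt_pos.2 hη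
  have hQd : ContDiff ℝ ∞ Q := hF.sqrt fun z => (hFpos z).ne'
  set E : ℝ → ℂ := fun θ => Complex.exp (θ * Complex.I) with hE
  have hEd : ContDiff ℝ ∞ E := by
    have : ContDiff ℝ ∞ fun θ : ℝ => (θ : ℂ) := Complex.ofRealCLM.contDiff
    exact (this.mul contDiff_const).cexp
  have hEper : Function.Periodic E (2 * Real.pi) := fun θ => by
    simp only [hE]
    rw [Complex.exp_eq_exp_iff_exists_int]
    exact ⟨1, by push_cast; ring⟩
  set r : ℝ → ℝ := fun θ => Q (E θ) with hr
  have hrd : ContDiff ℝ ∞ r := hQd.comp hEd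
  set g : ℝ → ℂ := fun θ => r θ * E θ with hg
  have hgd : ContDiff ℝ ∞ g := (Complex.ofRealCLM.contDiff.comp hrd).mul hEd
  have hgper : Function.Periodic g (2 * Real.pi) := fun θ => by
    simp only [hg, hr, hEper θ]
  have hg'd : ContDiff ℝ ∞ (deriv g) := (contDiff_infty_iff_deriv.1 hgd).2
  have hgdiff : Differentiable ℝ g := hgd.differentiable (by simp)
  have hrdiff : Differentiable ℝ r := hrd.differentiable (by simp)
  -- Here `g' = (r' + i r) * E`, and the first factor has imaginary part `r > 0`.
  have hg'0 : ∀ θ, deriv g θ ≠ 0 := by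
    intro θ
    have h1 : HasDerivAt E (E θ * Complex.I) θ := by
      have := ((Complex.ofRealCLM.hasDerivAt (x := θ)).mul_const Complex.I).cexp
      simpa using this
    have h2 := ((hrdiff θ).hasDerivAt.ofReal_comp).mul h1
    have h3 : deriv g θ = (deriv r θ + r θ * Complex.I) * E θ := by
      refine (HasDerivAt.deriv (f := g) h2).trans ?_
      ring
    rw [h3]
    refine mul_ne_zero (fun h0 => ?_) (Complex.exp_ne_zero _)
    have h4 := congrArg Complex.im h0
    simp at h4
    exact (hQpos _).ne' h4
  set w : ℝ → ℝ := fun θ => ‖deriv g θ‖ with hw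
  have hwpos : ∀ θ, 0 < w θ := fun θ => norm_pos_iff.2 (hg'0 θ)
  have hwper : Function.Periodic w (2 * Real.pi) := (deriv_periodic hgper).comp norm
  have hwd : ContDiff ℝ ∞ w := hg'd.norm ℝ hg'0
  obtain ⟨a, b, ha, hab⟩ := exists_bounds_of_periodic (by positivity) hwd.continuous hwper hwpos
  have hb : 0 < b := ha.trans_le ((hab 0).1.trans (hab 0).2)
  obtain ⟨φ, L, hL, hφs, hφd, hφ1⟩ := exists_reparametrization (T := 2 * Real.pi) (by positivity)
    hwd.continuous hwper hwpos
  have hφdiff : Differentiable ℝ φ := fun t => (hφd t).differentiableAt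
  have hφc : Continuous φ := hφdiff.continuous
  -- the unit tangent as a function of the angle
  set τ : ℝ → ℂ := fun θ => (w θ)⁻¹ • deriv g θ with hτ
  have hτd : ContDiff ℝ 1 τ :=
    ((hwd.inv fun θ => (hwpos θ).ne').smul hg'd).of_le (by exact_mod_cast le_top)
  have hτper : Function.Periodic τ (2 * Real.pi) := fun θ => by
    simp only [hτ, hwper θ, deriv_periodic hgper θ]
  obtain ⟨K, hK0, hK⟩ := exists_lipschitz_of_periodic (by positivity) hτd hτper
  have hper : Function.Periodic (fun t => c + g (φ t)) (1 : ℝ) := fun t => by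
    simp only [hφ1, hgper (φ t)]
  set γ : UnitAddCircle → ℂ := hper.lift with hγ
  have hlift : lift γ = fun t => c + g (φ t) := rfl
  set v : ℝ → ℂ := fun t => (L / w (φ t)) • deriv g (φ t) with hv
  have hd : ∀ t, HasDerivAt (lift γ) (v t) t := fun t => by
    rw [hlift]
    exact (((hgdiff (φ t)).hasDerivAt).scomp t (hφd t)).const_add c
  have hvc : Continuous v := by
    have h1 : Continuous fun t => L / w (φ t) :=
      continuous_const.div (hwd.continuous.comp hφc) fun t => (hwpos _).ne'
    exact h1.smul (hg'd.continuous.comp hφc)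
  have hvel : ∀ t, velocity γ t = v t := fun t => (hd t).deriv
  have hvn : ∀ t, ‖velocity γ t‖ = L := by
    intro t
    rw [hvel, hv, norm_smul, norm_div, Real.norm_of_nonneg hL.le, Real.norm_of_nonneg (hwpos _).le]
    exact div_mul_cancel₀ L (hwpos (φ t)).ne'
  have htan : ∀ t, tangent γ t = τ (φ t) := by
    intro t
    rw [tangent, hvn, hvel, hv, hτ]
    simp only [Complex.real_smul]
    have h1 : (L : ℂ) ≠ 0 := by exact_mod_cast hL.ne'
    have h2 : (w (φ t) : ℂ) ≠ 0 := by exact_mod_cast (hwpos _).ne'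
    push_cast
    field_simp
  have hlip : LipschitzWith L.toNNReal (lift γ) := by
    refine lipschitzWith_of_nnnorm_deriv_le (fun t => (hd t).differentiableAt) fun t => ?_
    rw [← NNReal.coe_le_coe, coe_nnnorm, Real.coe_toNNReal _ hL.le]
    exact (hvn t).le
  have hφup : ∀ t t', |φ t - φ t'| ≤ L / a * |t - t'| := by
    intro t t'
    refine convex_univ.norm_image_sub_le_of_norm_deriv_le (fun t _ => hφdiff t) (fun t _ => ?_)
      (mem_univ t') (mem_univ t)
    rw [(hφd t).deriv, norm_div, Real.norm_of_nonneg hL.le, Real.norm_of_nonneg (hwpos _).le]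
    exact div_le_div_of_nonneg_left hL.le ha (hab _).1
  have hφlow : ∀ t' t, t' ≤ t → L / b * (t - t') ≤ φ t - φ t' := by
    intro t' t htt
    refine mul_sub_le_image_sub_of_le_deriv hφdiff (fun t => ?_) htt
    rw [(hφd t).deriv]
    exact div_le_div_of_nonneg_left hL.le (hwpos _) (hab _).2
  have hlow : ∀ t' t, t' ≤ t → t - t' ≤ 1 / 2 →
      2 * √η * (L / b / Real.pi) * (t - t') ≤ ‖lift γ t - lift γ t'‖ := by
    intro t' t htt hle
    have h1 := hφlow t' t htt
    -- The angle still missing from a full turn is controlled by the remaining time `t' + 1 - t`, at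
    -- least `t - t'` because `t - t' ≤ 1 / 2`.
    have h2 := hφlow t (t' + 1) (by linarith)
    rw [hφ1] at h2
    have hκ : 0 ≤ L / b := by positivity
    have h3 := le_sin_half hκ (by linarith : 0 ≤ t - t') h1 (by nlinarith)
    have h4 := norm_polar_sub_ge (α := φ t) (β := φ t') hm.le (hQm (E (φ t))) (hQm (E (φ t')))
    have h5 : lift γ t - lift γ t' = Q (E (φ t)) * Complex.exp (φ t * Complex.I)
        - Q (E (φ t')) * Complex.exp (φ t' * Complex.I) := by
      rw [hlift]; simp only [hg, hr, hE]; ring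
    rw [h5]
    refine le_trans ?_ h4
    calc 2 * √η * (L / b / Real.pi) * (t - t') = 2 * √η * (L / b * (t - t') / Real.pi) := by ring
      _ ≤ 2 * √η * |Real.sin ((φ t - φ t') / 2)| := by
        gcongr
        exact h3.trans (le_abs_self _)
  have henergy : nonlocalEnergy s p γ < ⊤ := by
    refine nonlocalEnergy_lt_top hs0 hs1 hp (C := L) (A := K * (L / a))
      (B := 2 * √η * (L / b / Real.pi)) (fun t => (hvn t).le) (by positivity) (by positivity)
      (fun t t' _ => ?_) fun t t' h => ?_
    · rw [htan, htan, mul_assoc]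
      exact (hK _ _).trans (mul_le_mul_of_nonneg_left (hφup t t') hK0)
    · rcases le_total t' t with h1 | h1
      · rw [abs_of_nonneg (by linarith)] at h ⊢
        exact hlow t' t h1 h
      · rw [abs_sub_comm, abs_of_nonneg (by linarith)] at h ⊢
        rw [norm_sub_rev]
        exact hlow t t' h1 h
  obtain ⟨hon, h01, hint⟩ := interior_starShaped (Q := Q) hd hvc hQpos hφdiff hφs
    (by simpa using hφ1 0) (hrdiff.comp hφdiff) fun t => rfl
  refine ⟨γ, ⟨⟨_, lipschitzWith_of_lift hlip⟩, fun i => hon _ ?_, h01, ?_, L, hL,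
    Eventually.of_forall hvn⟩, ?_⟩
  · simp only [hQ, hFx, Real.sqrt_sq (norm_nonneg _)]
  · rw [hint, volume_starShaped hQd.continuous hQpos]
    congr 1
    have h1 : ∀ z, Q z ^ 2 / 2 = F z / 2 := fun z => by
      simp only [hQ, Real.sq_sqrt (hFpos z).le]
    simp only [h1]
    rw [intervalIntegral.integral_div, hFint]
    ring
  · exact ENNReal.add_lt_top.2 ⟨(length_le hlip).trans_lt ENNReal.coe_lt_top,
      ENNReal.mul_lt_top ENNReal.ofReal_lt_top henergy⟩

/-- Some admissible curve has finite energy. -/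
theorem exists_finite_energy {ε δ s p : ℝ} (hε : 0 < ε) (hs0 : 0 < s) (hs1 : s < 1) (hp : 1 ≤ p)
    {N : ℕ} (x : Fin N → ℂ) : ∃ γ ∈ admissible ε x, totalEnergy δ s p γ < ⊤ := by
  classical
  obtain ⟨c, hc, hdir⟩ := exists_center x
  set u : Fin N → ℂ := fun i => (x i - c) / ‖x i - c‖ with hu
  have hn : ∀ i, 0 < ‖x i - c‖ := fun i => norm_pos_iff.2 (sub_ne_zero.2 (hc i))
  -- By `hdir`, indices with the same direction carry the same point, so the choice does not matter,
  -- even for repeated points.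
  set ρ : ℂ → ℝ := fun z => if h : ∃ i, u i = z then ‖x h.choose - c‖ ^ 2 else 1 with hρ
  have hρu : ∀ i, ρ (u i) = ‖x i - c‖ ^ 2 := by
    intro i
    have h : ∃ j, u j = u i := ⟨i, rfl⟩
    simp only [hρ, dif_pos h]
    rw [hdir _ _ h.choose_spec]
  obtain ⟨F, hF, ⟨η, hη, hFη⟩, hFu, hFint⟩ := exists_radial_profile (Finset.univ.image u)
    (fun z hz => by
      obtain ⟨i, -, rfl⟩ := Finset.mem_image.1 hz
      rw [hu, norm_div, Complex.norm_real, norm_norm, div_self (hn i).ne'])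
    ρ (fun z hz => by
      obtain ⟨i, -, rfl⟩ := Finset.mem_image.1 hz
      rw [hρu]
      exact pow_pos (hn i) 2) (a := 2 * ε) (by positivity)
  refine exists_finite_energy_of_profile hs0 hs1 hp (c := c) hF hη hFη hFint fun i => ?_
  rw [← hρu i]
  exact hFu _ (Finset.mem_image_of_mem u (Finset.mem_univ i))

end

end ClosedCurve

theorem theorem1p1 (ε : ℝ) (hε : 0 < ε) (N : ℕ) (hN : 2 ≤ N) (x : Fin N → ℂ)
    (δ : ℝ) (hδ : 0 < δ) (s : ℝ) (hs : s ∈ Set.Ioo (0 : ℝ) 1) (p : ℝ) (hp : 1 ≤ p) :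
    ∃ γ ∈ ClosedCurve.admissible ε x,
      ClosedCurve.totalEnergy δ s p γ < ⊤ ∧
      ∀ γ' ∈ ClosedCurve.admissible ε x,
        ClosedCurve.totalEnergy δ s p γ ≤ ClosedCurve.totalEnergy δ s p γ' :=
  ClosedCurve.exists_minimizer hε (by omega) hδ hs.1 hp
    (ClosedCurve.exists_finite_energy hε hs.1 hs.2 hp x)
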